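/- Conventions. For a commutative real algebra $A$, let $C^\bullet(A)=\bigoplus_{k\ge 0}C^k(A)$, where $C^k(A)$ is the space of $\mathbb{R}$-multilinear maps $A^k\to A$. For $\phi\in C^k(A)$ and $\psi\in C^l(A)$ put $$(\phi\cup\psi)(a_1,\dots,a_{k+l})=\phi(a_1,\dots,a_k)\,\psi(a_{k+1},\dots,a_{k+l}),$$ $$(\phi\circ\psi)(a_1,\dots,a_{k+l-1})=\sum_{i=0}^{k-1}(-1)^{i(l-1)}\phi(a_1,\dots,a_i,\psi(a_{i+1},\dots,a_{i+l}),a_{i+l+1},\dots,a_{k+l-1}),$$ $$[\phi,\psi]=\phi\circ\psi-(-1)^{(k-1)(l-1)}\psi\circ\phi,$$ $$(\delta\phi)(a_0,\dots,a_k)=a_0\phi(a_1,\dots,a_k)+\sum_{i=0}^{k-1}(-1)^{i+1}\phi(a_0,\dots,a_ia_{i+1},\dots,a_k)+(-1)^{k+1}\phi(a_0,\dots,a_{k-1})a_k .$$ Let $\mathrm{HC}^k_{\mathrm{diff}}(A)\subseteq C^k(A)$ be the $k$-differential operators, i.e. the $\phi$ that in each argument are differential operators on $A$ (in the sense of iterated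 commutators with multiplications) of an order bounded independently of the other arguments. Let $\mathrm{HH}^\bullet_{\mathrm{diff}}(A)$ be the cohomology of $(\mathrm{HC}^\bullet_{\mathrm{diff}}(A),\delta)$. A Gerstenhaber algebra is a $\mathbb{Z}$-graded vector space with a unital associative product of degree $0$ and a bracket of degree $-1$ such that, for homogeneous elements, $ab=(-1)^{|a||b|}ba$, $[a,b]=-(-1)^{(|a|-1)(|b|-1)}[b,a]$, $[a,[b,c]]=[[a,b],c]+(-1)^{(|a|-1)(|b|-1)}[b,[a,c]]$ and $[ab,c]=[a,c]b+(-1)^{|a|(|c|-1)}a[b,c]$. A morphism of Gerstenhaber algebras is a degree preserving linear map compatible with unit, product and bracket. Let $\pi:E\to M$ be a smooth real vector bundle of finite rank over a finite-dimensional smooth Hausdorff manifold without boundary. A cochain $\phi\in\mathrm{HC}^k_{\mathrm{diff}}(C^\infty(E))$ is called vertical if $\phi(f_1,\dots,\pi^*u\,f_i,\dots,f_k)=\pi^*u\,\phi(f_1,\dots,f_k)$ for all $f_1,\dots,f_k\in C^\infty(E)$, $u\in C^\infty(M)$ and $i=1,\dots,k$. Let $\mathrm{HH}^\bullet_{\mathrm{diff,ver}}(C^\infty(E))$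 be the cohomology of the complex of vertical cochains. Proposition. 1. The cup product and the Gerstenhaber bracket of vertical differential cochains descend to $\mathrm{HH}^\bullet_{\mathrm{diff,ver}}(C^\infty(E))$ and make it a Gerstenhaber algebra. Likewise the cup product and the bracket of differential cochains make $\mathrm{HH}^\bullet_{\mathrm{diff}}(C^\infty(E))$ a Gerstenhaber algebra. The canonical map $\mathrm{HH}^\bullet_{\mathrm{diff,ver}}(C^\infty(E))\to\mathrm{HH}^\bullet_{\mathrm{diff}}(C^\infty(E))$ induced by the inclusion of cochains is a morphism of Gerstenhaber algebras. 2. Let $p\in M$, let $E_p$ be the fiber over $p$, and let $\iota_p:E_p\to E$ be the inclusion. For every vertical differential cochain $\phi$ of $C^\infty(E)$ there is a unique differential cochain $\iota_p^*\phi$ of $C^\infty(E_p)$ with $(\iota_p^*\phi)(\iota_p^*f_1,\dots,\iota_p^*f_k)=\iota_p^*(\phi(f_1,\dots,f_k))$ for all $f_1,\dots,f_k\in C^\infty(E)$. The cohomology $\mathrm{HH}^\bullet_{\mathrm{diff}}(C^\infty(E_p))$ is a Gerstenhaber algebra under the cup product and the Gerstenhaber bracket. The restriction $\iota_p^*$ maps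 vertical cocycles to cocycles and induces a well-defined morphism of Gerstenhaber algebras $\iota_p^*:\mathrm{HH}^\bullet_{\mathrm{diff,ver}}(C^\infty(E))\to\mathrm{HH}^\bullet_{\mathrm{diff}}(C^\infty(E_p))$, $[\phi]\mapsto[\iota_p^*\phi]$. -/

import Mathlib

open scoped Manifold ContDiff

noncomputable section

namespace VertHH

/-! ### Gerstenhaber algebras -/

section Gerstenhaber

/-- A Gerstenhaber algebra structure on a `ℤ`-graded module `H = ⨁ₖ 𝒢 k`: a unital associative
graded commutative product of degree `0` and a graded Lie bracket of degree `-1`, related by the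
graded Leibniz rule.  The sign in the Leibniz rule is the one of Gerstenhaber's original definition;
the other common form of the rule is the same statement for the opposite bracket
`(a, b) ↦ [b, a]`. -/
structure GerstenhaberAlgebra (R : Type*) (H : Type*) [CommRing R] [AddCommGroup H] [Module R H]
    (𝒢 : ℤ → Submodule R H) where
  mul : H →ₗ[R] H →ₗ[R] H
  one : H
  bracket : H →ₗ[R] H →ₗ[R] H
  isInternal : DirectSum.IsInternal 𝒢
  one_mem : one ∈ 𝒢 0
  mul_mem : ∀ {k l : ℤ} {a b : H}, a ∈ 𝒢 k → b ∈ 𝒢 l → mul a b ∈ 𝒢 (k + l)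
  bracket_mem : ∀ {k l : ℤ} {a b : H}, a ∈ 𝒢 k → b ∈ 𝒢 l → bracket a b ∈ 𝒢 (k + l - 1)
  one_mul : ∀ a, mul one a = a
  mul_one : ∀ a, mul a one = a
  mul_assoc : ∀ a b c, mul (mul a b) c = mul a (mul b c)
  graded_comm : ∀ {k l : ℤ} {a b : H}, a ∈ 𝒢 k → b ∈ 𝒢 l →
    mul a b = (k * l).negOnePow • mul b a
  bracket_antisymm : ∀ {k l : ℤ} {a b : H}, a ∈ 𝒢 k → b ∈ 𝒢 l →
    bracket a b = -(((k - 1) * (l - 1)).negOnePow • bracket b a)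
  jacobi : ∀ {k l m : ℤ} {a b c : H}, a ∈ 𝒢 k → b ∈ 𝒢 l → c ∈ 𝒢 m →
    bracket a (bracket b c) =
      bracket (bracket a b) c + ((k - 1) * (l - 1)).negOnePow • bracket b (bracket a c)
  leibniz : ∀ {k l m : ℤ} {a b c : H}, a ∈ 𝒢 k → b ∈ 𝒢 l → c ∈ 𝒢 m →
    bracket (mul a b) c = mul (bracket a c) b + (k * (m - 1)).negOnePow • mul a (bracket b c)

/-- A linear map between Gerstenhaber algebras is a morphism if it preserves the degree, the unit,
the product and the bracket. -/
structure IsGerstenhaberHom {R H H' : Type*} [CommRing R] [AddCommGroup H] [Module R H]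
    [AddCommGroup H'] [Module R H'] {𝒢 : ℤ → Submodule R H} {𝒢' : ℤ → Submodule R H'}
    (G : GerstenhaberAlgebra R H 𝒢) (G' : GerstenhaberAlgebra R H' 𝒢') (f : H →ₗ[R] H') :
    Prop where
  map_mem : ∀ {k : ℤ} {a : H}, a ∈ 𝒢 k → f a ∈ 𝒢' k
  map_one : f G.one = G'.one
  map_mul : ∀ a b, f (G.mul a b) = G'.mul (f a) (f b)
  map_bracket : ∀ a b, f (G.bracket a b) = G'.bracket (f a) (f b)

end Gerstenhaber

/-! ### Differential operators on a commutative algebra -/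

section DiffOp

variable {A : Type*} [CommRing A]

/-- `D : A → A` is a differential operator of order `< n` on the commutative algebra `A` (in the
usual algebraic sense): it is zero for `n = 0`, and for `n + 1` all its commutators with
multiplication operators have order `< n`.  On `A = C^∞(N)` these are the usual differential
operators of order `< n` on the manifold `N`. -/
def DiffOrderLT : ℕ → (A → A) → Prop
  | 0, D => ∀ a, D a = 0
  | n + 1, D => ∀ a, DiffOrderLT n (fun b => D (a * b) - a * D b)

theorem DiffOrderLT.zero (n : ℕ) : DiffOrderLT n (fun _ : A => (0 : A)) := by
  induction n with
  | zero => intro a; rfl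
  | succ n ih => intro a; simpa using ih

theorem DiffOrderLT.add {n : ℕ} {D D' : A → A} (h : DiffOrderLT n D) (h' : DiffOrderLT n D') :
    DiffOrderLT n (fun b => D b + D' b) := by
  induction n generalizing D D' with
  | zero => intro a; simp [h a, h' a]
  | succ n ih =>
    intro a
    convert ih (h a) (h' a) using 2
    ring

theorem DiffOrderLT.smul [Algebra ℝ A] {n : ℕ} {D : A → A} (c : ℝ) (h : DiffOrderLT n D) :
    DiffOrderLT n (fun b => c • D b) := by
  induction n generalizing D with
  | zero => intro a; simp [h a]
  | succ n ih =>
    intro a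
    convert ih (h a) using 2
    rw [smul_sub, mul_smul_comm]

theorem DiffOrderLT.succ {n : ℕ} {D : A → A} (h : DiffOrderLT n D) : DiffOrderLT (n + 1) D := by
  induction n generalizing D with
  | zero => intro a b; simp [h (a * b), h b]
  | succ n ih => intro a; exact ih (h a)

theorem DiffOrderLT.mono {n m : ℕ} (hnm : n ≤ m) {D : A → A} (h : DiffOrderLT n D) :
    DiffOrderLT m D := by
  induction hnm with
  | refl => exact h
  | step _ ih => exact ih.succ

end DiffOp

/-! ### Hochschild cochains -/

section Hochschild

variable {A : Type*} [CommRing A] [Algebra ℝ A]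

variable (A) in
/-- A (not necessarily homogeneous) Hochschild cochain of the algebra `A` with values in `A` is a
family `(φₖ)ₖ` of maps `φₖ : Aᵏ → A`, written as one function on finite sequences:
`φ [a₁, …, aₖ] = φₖ(a₁, …, aₖ)`.  Multilinearity of the `φₖ` and vanishing of all but finitely many
of them are imposed in `HC`. -/
abbrev Cochain : Type _ := List A → A

/-- The cochain is homogeneous of degree `k`: only its `k`-ary component may be nonzero. -/
def IsHomog (k : ℤ) (φ : Cochain A) : Prop := ∀ L : List A, (L.length : ℤ) ≠ k → φ L = 0

variable (A) in
/-- The space `⨁ₖ Hom(A^{⊗k}, A)` of Hochschild cochains: every component is `ℝ`-linear in every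
argument, and only finitely many components are nonzero. -/
def HC : Submodule ℝ (Cochain A) where
  carrier := {φ | (∀ (K L : List A) (a b : A) (s t : ℝ),
      φ (K ++ (s • a + t • b) :: L) = s • φ (K ++ a :: L) + t • φ (K ++ b :: L)) ∧
    ∃ N : ℕ, ∀ L : List A, N < L.length → φ L = 0}
  zero_mem' := ⟨by intros; simp, 0, by intros; simp⟩
  add_mem' := by
    rintro φ ψ ⟨h₁, N₁, hN₁⟩ ⟨h₂, N₂, hN₂⟩
    refine ⟨fun K L a b s t => ?_, max N₁ N₂, fun L hL => ?_⟩
    · simp only [Pi.add_apply, h₁, h₂, smul_add]; abel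
    · simp [hN₁ L (lt_of_le_of_lt (le_max_left _ _) hL),
        hN₂ L (lt_of_le_of_lt (le_max_right _ _) hL)]
  smul_mem' := by
    rintro c φ ⟨h, N, hN⟩
    refine ⟨fun K L a b s t => ?_, N, fun L hL => ?_⟩
    · simp only [Pi.smul_apply, h, smul_add, smul_comm c]
    · simp [hN L hL]

/-- The cup product `(φ ∪ ψ)(a₁, …, aₙ) = φ(a₁, …, aₖ) ψ(aₖ₊₁, …, aₙ)` for `φ` of degree `k`
and `ψ` of degree `n - k` (summed over `k` for inhomogeneous cochains). -/
def cup (φ ψ : Cochain A) : Cochain A := fun L =>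
  ∑ k ∈ Finset.range (L.length + 1), φ (L.take k) * ψ (L.drop k)

/-- The unit of the cup product: the element `1 ∈ A` as a `0`-cochain. -/
def unitCochain : Cochain A
  | [] => 1
  | _ :: _ => 0

/-- Gerstenhaber's composition product
`(φ ∘ ψ)(a₁, …, a_{k+l-1})
  = ∑ᵢ (-1)^{i(l-1)} φ(a₁, …, aᵢ, ψ(aᵢ₊₁, …, aᵢ₊ₗ), aᵢ₊ₗ₊₁, …, a_{k+l-1})`
with `0 ≤ i ≤ k - 1`, for `φ` of degree `k` and `ψ` of degree `l` (summed over `k`, `l` for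
inhomogeneous cochains). -/
def circ (φ ψ : Cochain A) : Cochain A := fun L =>
  ∑ l ∈ Finset.range (L.length + 1), ∑ i ∈ Finset.range (L.length - l + 1),
    (-1) ^ (i * (l + 1)) * φ (L.take i ++ ψ ((L.drop i).take l) :: L.drop (i + l))

/-- The Gerstenhaber bracket `[φ, ψ] = φ ∘ ψ - (-1)^{(k-1)(l-1)} ψ ∘ φ` of a cochain `φ` of
degree `k` and a cochain `ψ` of degree `l`. -/
def gBracket (k l : ℕ) (φ ψ : Cochain A) : Cochain A :=
  circ φ ψ - (-1 : ℝ) ^ ((k + 1) * (l + 1)) • circ ψ φ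

/-- The Hochschild differential
`(δφ)(a₀, …, aₖ) = a₀ φ(a₁, …, aₖ) + ∑ᵢ (-1)^{i+1} φ(a₀, …, aᵢaᵢ₊₁, …, aₖ)
  + (-1)^{k+1} φ(a₀, …, aₖ₋₁) aₖ`, with `0 ≤ i ≤ k - 1`. -/
def hochschildFun (φ : Cochain A) : Cochain A
  | [] => 0
  | a :: T =>
    a * φ T
      + ∑ i ∈ Finset.range T.length, (-1) ^ (i + 1) *
          φ ((a :: T).take i ++ (((a :: T).drop i).take 2).prod :: (a :: T).drop (i + 2))
      + (-1) ^ (T.length + 1) * (φ (a :: T).dropLast * (a :: T).getLast (List.cons_ne_nil a T))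

variable (A) in
/-- The Hochschild differential as a linear map. -/
def hochschild : Cochain A →ₗ[ℝ] Cochain A where
  toFun := hochschildFun
  map_add' φ ψ := by
    funext L
    cases L with
    | nil => simp [hochschildFun]
    | cons a T =>
      simp only [hochschildFun, Pi.add_apply, mul_add, add_mul, Finset.sum_add_distrib]
      ring
  map_smul' c φ := by
    funext L
    cases L with
    | nil => simp [hochschildFun]
    | cons a T =>
      simp only [hochschildFun, Pi.smul_apply, mul_smul_comm, smul_mul_assoc, smul_add,
        Finset.smul_sum, RingHom.id_apply]

/-! ### Cohomology of a subcomplex of the Hochschild complex -/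

/-- The cocycles lying in the space `S` of cochains. -/
def cocycles (S : Submodule ℝ (Cochain A)) : Submodule ℝ (Cochain A) :=
  S ⊓ LinearMap.ker (hochschild A)

/-- The coboundaries of the cochains in `S`. -/
def coboundaries (S : Submodule ℝ (Cochain A)) : Submodule ℝ (Cochain A) :=
  S.map (hochschild A)

/-- The cohomology of the subcomplex `S`: cocycles in `S` modulo coboundaries of elements
of `S`. -/
abbrev HH (S : Submodule ℝ (Cochain A)) : Type _ :=
  cocycles S ⧸ (coboundaries S).submoduleOf (cocycles S)

/-- The class of a cocycle. -/
def HH.mk (S : Submodule ℝ (Cochain A)) : cocycles S →ₗ[ℝ] HH S :=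
  ((coboundaries S).submoduleOf (cocycles S)).mkQ

/-- The degree `k` part of the cohomology: classes of homogeneous cocycles of degree `k`. -/
def HH.deg (S : Submodule ℝ (Cochain A)) (k : ℤ) : Submodule ℝ (HH S) :=
  Submodule.map (HH.mk S)
    { carrier := {z | IsHomog k (z : Cochain A)}
      zero_mem' := fun _ _ => rfl
      add_mem' := fun {x y} hx hy L hL => by
        simp [hx L hL, hy L hL]
      smul_mem' := fun c x hx L hL => by
        simp [hx L hL] }

/-- The canonical map between the cohomologies of two subcomplexes, one contained in the other,
sending the class of a cocycle to its class in the larger complex. -/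
def HH.map {S T : Submodule ℝ (Cochain A)} (h : S ≤ T) : HH S →ₗ[ℝ] HH T :=
  Submodule.mapQ _ _ (Submodule.inclusion (inf_le_inf_right _ h)) (by
    rintro ⟨x, hx⟩ hxB
    exact Submodule.map_mono h hxB)

/-- The Gerstenhaber algebra structure `G` on the cohomology of `S` is the one given by the cup
product and the Gerstenhaber bracket of cochains: these operations turn cocycles in `S` into
cocycles in `S`, and on classes they are the product and the bracket of `G`. -/
structure IsInduced {S : Submodule ℝ (Cochain A)}
    (G : GerstenhaberAlgebra ℝ (HH S) (HH.deg S)) : Prop where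
  one : ∃ h : unitCochain ∈ cocycles S, G.one = HH.mk S ⟨unitCochain, h⟩
  mul : ∀ z w : cocycles S, ∃ h : cup (z : Cochain A) w ∈ cocycles S,
    G.mul (HH.mk S z) (HH.mk S w) = HH.mk S ⟨cup z w, h⟩
  bracket : ∀ (k l : ℕ) (z w : cocycles S), IsHomog k (z : Cochain A) → IsHomog l (w : Cochain A) →
    ∃ h : gBracket k l (z : Cochain A) w ∈ cocycles S,
      G.bracket (HH.mk S z) (HH.mk S w) = HH.mk S ⟨gBracket k l z w, h⟩

/-! ### Differential cochains -/

variable (A) in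
/-- The differential Hochschild cochains `HC_diff(A)`: the `k`-ary component is a `k`-differential
operator for every `k`, i.e. it is `ℝ`-multilinear and there is a bound `r` such that in each of
its `k` arguments (the others being fixed) it is a differential operator of order `< r`. -/
def HCdiff : Submodule ℝ (Cochain A) where
  carrier := {φ | φ ∈ HC A ∧ ∀ k : ℕ, ∃ r : ℕ, ∀ K L : List A, K.length + 1 + L.length = k →
    DiffOrderLT r (fun a => φ (K ++ a :: L))}
  zero_mem' := ⟨zero_mem _, fun _ => ⟨0, fun _ _ _ => DiffOrderLT.zero 0⟩⟩
  add_mem' := by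
    rintro φ ψ ⟨h₁, d₁⟩ ⟨h₂, d₂⟩
    refine ⟨add_mem h₁ h₂, fun k => ?_⟩
    obtain ⟨r₁, hr₁⟩ := d₁ k
    obtain ⟨r₂, hr₂⟩ := d₂ k
    exact ⟨max r₁ r₂, fun K L hk => ((hr₁ K L hk).mono (le_max_left _ _)).add
      ((hr₂ K L hk).mono (le_max_right _ _))⟩
  smul_mem' := by
    rintro c φ ⟨h, d⟩
    refine ⟨Submodule.smul_mem _ c h, fun k => ?_⟩
    obtain ⟨r, hr⟩ := d k
    exact ⟨r, fun K L hk => (hr K L hk).smul c⟩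

/-- The cochains that are linear in every argument over the image of a ring homomorphism
`π : C → A`. -/
def HClinear {C : Type*} [CommRing C] (π : C →+* A) : Submodule ℝ (Cochain A) where
  carrier := {φ | ∀ (K L : List A) (u : C) (a : A),
    φ (K ++ (π u * a) :: L) = π u * φ (K ++ a :: L)}
  zero_mem' := by intro K L u a; simp
  add_mem' := by
    intro φ ψ h₁ h₂ K L u a
    simp only [Pi.add_apply, h₁ K L u a, h₂ K L u a, mul_add]
  smul_mem' := by
    intro c φ h K L u a
    simp only [Pi.smul_apply, h K L u a, mul_smul_comm]

end Hochschild

/-! ### Smooth functions on a finite-dimensional vector space -/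

/-- The algebra `C^∞(V)` of smooth functions on a finite-dimensional real vector space `V`:
the functions that are smooth in linear coordinates. -/
def smoothFun (V : Type*) [AddCommGroup V] [Module ℝ V] : Subalgebra ℝ (V → ℝ) where
  carrier := {f | ∀ (n : ℕ) (L : (Fin n → ℝ) ≃ₗ[ℝ] V), ContDiff ℝ ∞ (fun x => f (L x))}
  mul_mem' := fun hf hg n L => (hf n L).mul (hg n L)
  add_mem' := fun hf hg n L => (hf n L).add (hg n L)
  algebraMap_mem' := fun _ _ _ => contDiff_const

/-! ### Vector bundles -/

section Bundle

set_option linter.unusedSectionVars false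

variable (EB : Type*) [NormedAddCommGroup EB] [NormedSpace ℝ EB]
  {M : Type*} [TopologicalSpace M] [ChartedSpace EB M]
  (F : Type*) [NormedAddCommGroup F] [NormedSpace ℝ F]
  (E : M → Type*) [TopologicalSpace (Bundle.TotalSpace F E)] [∀ x, TopologicalSpace (E x)]
  [∀ x, AddCommGroup (E x)] [∀ x, Module ℝ (E x)]
  [FiberBundle F E] [VectorBundle ℝ F E] [ContMDiffVectorBundle ∞ F E 𝓘(ℝ, EB)]

variable (M) in
/-- The algebra `C^∞(M)` of smooth functions on the base. -/
abbrev CInfBase : Type _ := C^∞⟮𝓘(ℝ, EB), M; 𝓘(ℝ, ℝ), ℝ⟯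

/-- The algebra `C^∞(E)` of smooth functions on the total space. -/
abbrev CInfTotal : Type _ :=
  C^∞⟮𝓘(ℝ, EB).prod 𝓘(ℝ, F), Bundle.TotalSpace F E; 𝓘(ℝ, ℝ), ℝ⟯

/-- The pull-back `π^* : C^∞(M) → C^∞(E)` along the bundle projection. -/
def pullback : CInfBase EB M →+* CInfTotal EB F E where
  toFun u := ⟨fun v => u v.proj, u.contMDiff.comp (Bundle.contMDiff_proj E)⟩
  map_one' := rfl
  map_mul' _ _ := rfl
  map_zero' := rfl
  map_add' _ _ := rfl

/-- The vertical differential Hochschild cochains `HC_{diff,ver}(C^∞(E))`: the differential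
cochains `φ` with `φ(f₁, …, π^*u fᵢ, …, fₖ) = π^*u φ(f₁, …, fₖ)` for all `u ∈ C^∞(M)` and
all `i`. -/
def HCver : Submodule ℝ (Cochain (CInfTotal EB F E)) :=
  HCdiff (CInfTotal EB F E) ⊓ HClinear (pullback EB F E)

theorem HCver_le : HCver EB F E ≤ HCdiff (CInfTotal EB F E) := inf_le_left

variable {E} in
theorem contMDiff_fiber_inclusion (p : M) (n : ℕ) (L : (Fin n → ℝ) ≃ₗ[ℝ] E p) :
    ContMDiff 𝓘(ℝ, Fin n → ℝ) (𝓘(ℝ, EB).prod 𝓘(ℝ, F)) ∞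
      (fun x => (⟨p, L x⟩ : Bundle.TotalSpace F E)) := by
  intro x
  rw [Bundle.contMDiffAt_totalSpace]
  refine ⟨contMDiffAt_const, ?_⟩
  have hp : p ∈ (trivializationAt F E p).baseSet := FiberBundle.mem_baseSet_trivializationAt' p
  have key : (fun y : Fin n → ℝ => (trivializationAt F E p ⟨p, L y⟩).2) =
      fun y => ((((trivializationAt F E p).linearEquivAt ℝ p hp).toLinearMap ∘ₗ
        L.toLinearMap).toContinuousLinearMap) y := by
    funext y
    rfl
  change ContMDiffAt _ _ _ (fun y : Fin n → ℝ => (trivializationAt F E p ⟨p, L y⟩).2) x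
  rw [key]
  exact (ContinuousLinearMap.contDiff _).contMDiff.contMDiffAt

/-- The restriction `ι_p^* : C^∞(E) → C^∞(E_p)` of functions to the fiber over `p`. -/
def restrict (p : M) (f : CInfTotal EB F E) : smoothFun (E p) :=
  ⟨fun v => f ⟨p, v⟩, fun n L =>
    contMDiff_iff_contDiff.mp (f.contMDiff.comp (contMDiff_fiber_inclusion EB F p n L))⟩

/-- The cochain `ψ` of `C^∞(E_p)` is the restriction `ι_p^*φ` of the cochain `φ` of `C^∞(E)` to the
fiber over `p`: `ψ(ι_p^*f₁, …, ι_p^*fₖ) = ι_p^*(φ(f₁, …, fₖ))` for all `f₁, …, fₖ ∈ C^∞(E)`. -/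
def IsRestriction (p : M) (φ : Cochain (CInfTotal EB F E)) (ψ : Cochain (smoothFun (E p))) : Prop :=
  ∀ L : List (CInfTotal EB F E), ψ (L.map (restrict EB F E p)) = restrict EB F E p (φ L)

end Bundle

end VertHH

end

/-!
The theorem has an algebraic part, the Gerstenhaber algebra structures, which needs nothing about
`C^∞(E)` beyond its being a commutative algebra, and a geometric part, the restriction to a fiber.

**Algebraic part.** Cochains are functions on words in the letters `A`. Functions on words with
values in a ring form a ring under convolution (`Conv`), and for values in `A` its product is the
cup product. Gerstenhaber's product is the insertion `ins ε φ ψ`, with `ε = (-1)^(deg ψ - 1)`, and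
there is also the brace `ins₂ ε η φ ψ χ`, in which `ψ` and `χ` are inserted into `φ` one behind the
other. Both satisfy Leibniz rules with respect to convolution (`ins_mul`, `ins₂_mul`). Every
multilinear function on words is the image, under a linear map of the values, of the word
`a₁ ⋯ aₙ` in an algebra of operators (`map_ev`), and insertions commute with such maps. So an
identity between insertions has to be checked for the word only, where
`ins ε (word) z = tw ε (word) * z * word` turns it into an identity of a noncommutative ring. This
gives the pre-Lie identity `preLie`, hence the Jacobi identity `br_jacobi`. The Hochschild
differential is made of the cup product and of the insertion of the product of `A`
(`hochschild_eq_dif`), so the same calculus shows that the differential of `ins η φ ψ` is, on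
cocycles, the graded commutator of the cup product (`dif_ins`), and that the differential of the
brace is the defect of the Leibniz rule (`dif_ins₂`). Thus every space of cochains that is closed
under these operations has a Gerstenhaber algebra as its cohomology
(`BraceClosed.exists_gerstenhaber`), and the spaces of differential and of vertical differential
cochains are closed, as sums and composites of multidifferential operators are multidifferential
(`braceClosed_of_mem_iff`). Inhomogeneous cochains are split into their parts of even and odd
degree, since the signs depend on the parities only.

**Geometric part.** Restriction to the fiber over `p` is a surjective homomorphism
`C^∞(E) → C^∞(E_p)` (`restrict_surjective`), whose kernel is the ideal generated by the pull-backs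
of the functions on `M` that vanish at `p` (`mem_span_of_restrict_eq_zero`); this is Hadamard's
lemma with parameters in a trivialization, globalized with a bump function on the base. By
verticality, replacing an argument by one with the same restriction does not change the restriction
of the value, so that a vertical cochain descends to `C^∞(E_p)` (`isImage_descend`). All operations
are given by the same formulas upstairs and downstairs, which makes the induced map of cohomologies
a morphism (`exists_isGerstenhaberHom_descend`).
-/

namespace VertHH

/-! ### The convolution algebra of functions on words -/

section Conv

set_option linter.unusedSectionVars false

/-- Functions on words in the letters `A` with values in `R`, as a ring under convolution over
the deconcatenations of a word.  For `R = A` these are the Hochschild cochains with the cup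
product. -/
def Conv (A R : Type*) : Type _ := List A → R

namespace Conv

variable {A R R' : Type*} [Ring R] [Algebra ℝ R] [Ring R'] [Algebra ℝ R']

instance : AddCommGroup (Conv A R) := inferInstanceAs (AddCommGroup (List A → R))

instance {S : Type*} [Semiring S] [Module S R] : Module S (Conv A R) :=
  inferInstanceAs (Module S (List A → R))

@[ext] theorem ext {f g : Conv A R} (h : ∀ L, f L = g L) : f = g := funext h

@[simp] theorem add_apply (f g : Conv A R) (L : List A) : (f + g) L = f L + g L := rfl
@[simp] theorem sub_apply (f g : Conv A R) (L : List A) : (f - g) L = f L - g L := rfl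
@[simp] theorem neg_apply (f : Conv A R) (L : List A) : (-f) L = -f L := rfl
@[simp] theorem zero_apply (L : List A) : (0 : Conv A R) L = 0 := rfl
@[simp] theorem smul_apply {S : Type*} [Semiring S] [Module S R] (s : S) (f : Conv A R)
    (L : List A) : (s • f) L = s • f L := rfl

/-- The derivative of a function on words by a letter: the letter is put in front of the word. -/
def D (a : A) (f : Conv A R) : Conv A R := fun L => f (a :: L)

@[simp] theorem D_apply (a : A) (f : Conv A R) (L : List A) : D a f L = f (a :: L) := rfl
@[simp] theorem D_add (a : A) (f g : Conv A R) : D a (f + g) = D a f + D a g := rfl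
@[simp] theorem D_smul {S : Type*} [Semiring S] [Module S R] (s : S) (a : A) (f : Conv A R) :
    D a (s • f) = s • D a f := rfl

/-- The sum over all ways of cutting a word in two, where the first part chooses the function that
is applied to the second part. -/
def csum (Φ : List A → Conv A R) : Conv A R := fun L =>
  ∑ k ∈ Finset.range (L.length + 1), Φ (L.take k) (L.drop k)

@[simp] theorem csum_nil (Φ : List A → Conv A R) : csum Φ [] = Φ [] [] := by simp [csum]

@[simp] theorem csum_cons (Φ : List A → Conv A R) (a : A) (L : List A) :
    csum Φ (a :: L) = Φ [] (a :: L) + csum (fun K => Φ (a :: K)) L := by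
  simp only [csum, List.length_cons]
  rw [Finset.sum_range_succ', add_comm]
  simp

theorem csum_add (Φ Ψ : List A → Conv A R) :
    csum (fun K => Φ K + Ψ K) = csum Φ + csum Ψ := by
  ext L; simp [csum, Finset.sum_add_distrib]

theorem csum_smul {S : Type*} [Semiring S] [Module S R] (s : S) (Φ : List A → Conv A R) :
    csum (fun K => s • Φ K) = s • csum Φ := by
  ext L; simp [csum, Finset.smul_sum]

instance : Mul (Conv A R) := ⟨fun f g => csum fun K => f K • g⟩

theorem mul_def (f g : Conv A R) : f * g = csum fun K => f K • g := rfl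

@[simp] theorem mul_nil (f g : Conv A R) : (f * g) [] = f [] * g [] := by
  simp [mul_def]

@[simp] theorem mul_cons (f g : Conv A R) (a : A) (L : List A) :
    (f * g) (a :: L) = f [] * g (a :: L) + (D a f * g) L := by
  simp [mul_def]

theorem D_mul (f g : Conv A R) (a : A) : D a (f * g) = f [] • D a g + D a f * g := by
  ext L; simp

protected theorem add_mul' (f g h : Conv A R) : (f + g) * h = f * h + g * h := by
  simp [mul_def, add_smul, csum_add]

protected theorem mul_add' (f g h : Conv A R) : f * (g + h) = f * g + f * h := by
  simp [mul_def, smul_add, csum_add]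

theorem smul_mul_left (r : R) (f g : Conv A R) : (r • f) * g = r • (f * g) := by
  simp [mul_def, mul_smul, csum_smul]

theorem real_smul_mul (s : ℝ) (f g : Conv A R) : (s • f) * g = s • (f * g) := by
  ext L; simp [mul_def, csum, Finset.smul_sum]

theorem mul_real_smul (s : ℝ) (f g : Conv A R) : f * (s • g) = s • (f * g) := by
  ext L; simp [mul_def, csum, Finset.smul_sum]

/-- Cutting a word in three, first before the second cut or first after it. -/
theorem csum_mul (Φ : List A → Conv A R) (g : Conv A R) :
    csum Φ * g = csum fun K => Φ K * g := by
  ext L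
  induction L generalizing Φ with
  | nil => simp
  | cons a L ih =>
    have : D a (csum Φ) = D a (Φ []) + csum fun K => Φ (a :: K) := by ext L; simp
    rw [mul_cons, this, Conv.add_mul', add_apply, ih, csum_cons, mul_cons]
    simp [add_assoc]

instance : One (Conv A R) := ⟨fun L => if L = [] then 1 else 0⟩

theorem one_def (L : List A) : (1 : Conv A R) L = if L = [] then 1 else 0 := rfl
@[simp] theorem one_nil : (1 : Conv A R) [] = 1 := rfl
@[simp] theorem one_cons (a : A) (L : List A) : (1 : Conv A R) (a :: L) = 0 := by
  simp [one_def]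

protected theorem zero_mul' (f : Conv A R) : 0 * f = 0 := by
  ext L; simp [mul_def, csum]

instance : Ring (Conv A R) where
  __ := (inferInstance : AddCommGroup (Conv A R))
  mul_assoc f g h := by
    rw [mul_def f g, csum_mul]
    simp only [smul_mul_left]; rfl
  one_mul f := by
    ext L
    cases L with
    | nil => simp
    | cons a L =>
      rw [mul_cons, show D a (1 : Conv A R) = 0 by ext L; simp, Conv.zero_mul']
      simp
  mul_one f := by
    ext L
    induction L generalizing f with
    | nil => simp
    | cons a L ih => rw [mul_cons, ih]; simp
  left_distrib := Conv.mul_add'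
  right_distrib := Conv.add_mul'
  zero_mul := Conv.zero_mul'
  mul_zero f := by ext L; simp [mul_def, csum]

noncomputable instance : Algebra ℝ (Conv A R) :=
  Algebra.ofModule real_smul_mul mul_real_smul

/-- The endomorphism of the convolution algebra that multiplies words of length `n` by `εⁿ`. -/
def tw (ε : ℝ) (f : Conv A R) : Conv A R := fun L => ε ^ L.length • f L

@[simp] theorem tw_nil (ε : ℝ) (f : Conv A R) : tw ε f [] = f [] := by simp [tw]

@[simp] theorem tw_cons (ε : ℝ) (f : Conv A R) (a : A) (L : List A) :
    tw ε f (a :: L) = ε • tw ε (D a f) L := by simp [tw, pow_succ', mul_smul]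

theorem tw_apply (ε : ℝ) (f : Conv A R) (L : List A) : tw ε f L = ε ^ L.length • f L := rfl

@[simp] theorem D_tw (ε : ℝ) (f : Conv A R) (a : A) : D a (tw ε f) = ε • tw ε (D a f) := by
  ext L; simp

@[simp] theorem tw_one (f : Conv A R) : tw 1 f = f := by ext L; simp [tw]

theorem tw_tw (ε η : ℝ) (f : Conv A R) : tw ε (tw η f) = tw (ε * η) f := by
  ext L; simp [tw, mul_pow, mul_smul]

@[simp] theorem tw_add (ε : ℝ) (f g : Conv A R) : tw ε (f + g) = tw ε f + tw ε g := by
  ext L; simp [tw]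

@[simp] theorem tw_sub (ε : ℝ) (f g : Conv A R) : tw ε (f - g) = tw ε f - tw ε g := by
  ext L; simp [tw, smul_sub]

@[simp] theorem tw_neg (ε : ℝ) (f : Conv A R) : tw ε (-f) = -tw ε f := by
  ext L; simp [tw]

@[simp] theorem tw_smul (ε s : ℝ) (f : Conv A R) : tw ε (s • f) = s • tw ε f := by
  ext L; simp [tw, smul_comm s]

theorem tw_mul (ε : ℝ) (f g : Conv A R) : tw ε (f * g) = tw ε f * tw ε g := by
  ext L
  simp only [tw, mul_def, csum, Finset.smul_sum]
  refine Finset.sum_congr rfl fun k hk => ?_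
  have : L.length = (L.take k).length + (L.drop k).length := by
    rw [← List.length_append, List.take_append_drop]
  rw [this, pow_add, smul_apply, smul_apply, tw_apply, smul_eq_mul, smul_eq_mul, mul_smul,
    smul_mul_assoc, mul_smul_comm]

/-! ### Insertion operations -/

/-- Insertion of a cochain at the front: the sum of the `f (z L₁ :: L₂)` over all `L = L₁L₂`. -/
def hd (f : Conv A R) (z : Conv A A) : Conv A R := csum fun K => D (z K) f

/-- Insertion of the cochain `z` into `f`: the sum of the `ε^|L₀| f (L₀ ++ z L₁ :: L₂)` over all
`L = L₀L₁L₂`.  For `z` of degree `m` and `ε = (-1)^(m-1)` this is Gerstenhaber's product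
`f ∘ z`. -/
def ins (ε : ℝ) (f : Conv A R) (z : Conv A A) : Conv A R
  | [] => hd f z []
  | a :: L => hd f z (a :: L) + ε • ins ε (D a f) z L

/-- The brace `f{z, w}` with its first insertion at the front: the sum of the
`η^|L₁L₂| f (z L₁ :: L₂ ++ w L₃ :: L₄)` over all `L = L₁L₂L₃L₄`. -/
noncomputable def hd₂ (η : ℝ) (f : Conv A R) (z w : Conv A A) : Conv A R :=
  csum fun K => η ^ K.length • ins η (D (z K) f) w

/-- The brace `f{z, w}`: the sum of the
`ε^|L₀| η^|L₀L₁L₂| f (L₀ ++ z L₁ :: L₂ ++ w L₃ :: L₄)` over all `L = L₀L₁L₂L₃L₄`. -/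
noncomputable def ins₂ (ε η : ℝ) (f : Conv A R) (z w : Conv A A) : Conv A R
  | [] => hd₂ η f z w []
  | a :: L => hd₂ η f z w (a :: L) + (ε * η) • ins₂ ε η (D a f) z w L

variable (ε η : ℝ) (f g : Conv A R) (z w : Conv A A)

theorem hd_mul : hd (f * g) z = f [] • hd g z + hd f z * g := by
  simp only [hd, D_mul, csum_add, csum_smul, csum_mul]

@[simp] theorem hd_add : hd (f + g) z = hd f z + hd g z := by simp [hd, csum_add]

@[simp] theorem hd_smul {S : Type*} [Semiring S] [Module S R] (s : S) :
    hd (s • f) z = s • hd f z := by simp [hd, csum_smul]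

@[simp] theorem ins_nil : ins ε f z [] = hd f z [] := rfl
@[simp] theorem ins_cons (a : A) (L : List A) :
    ins ε f z (a :: L) = hd f z (a :: L) + ε • ins ε (D a f) z L := rfl

@[simp] theorem D_ins (a : A) : D a (ins ε f z) = D a (hd f z) + ε • ins ε (D a f) z := rfl

@[simp] theorem ins_add : ins ε (f + g) z = ins ε f z + ins ε g z := by
  ext L
  induction L generalizing f g with
  | nil => simp
  | cons a L ih => simp [ih]; abel

@[simp] theorem ins_smul {S : Type*} [Ring S] [Module S R] [SMulCommClass S ℝ R] (s : S) :
    ins ε (s • f) z = s • ins ε f z := by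
  ext L
  induction L generalizing f with
  | nil => simp
  | cons a L ih => simp [ih, smul_comm s]

@[simp] theorem ins_neg : ins ε (-f) z = -ins ε f z := by
  rw [← neg_one_smul ℝ f, ins_smul, neg_one_smul]

@[simp] theorem ins_sub : ins ε (f - g) z = ins ε f z - ins ε g z := by
  rw [sub_eq_add_neg, ins_add, ins_neg, sub_eq_add_neg]

/-- Insertion of a cochain is a twisted derivation of the convolution product. -/
theorem ins_mul : ins ε (f * g) z = ins ε f z * g + tw ε f * ins ε g z := by
  ext L
  induction L generalizing f g with
  | nil => simp [hd_mul, add_comm]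
  | cons a L ih =>
    simp only [ins_cons, hd_mul, D_mul, ins_add, ins_smul, add_apply, smul_apply, ih, mul_cons,
      D_ins, D_tw, tw_nil, add_mul, smul_mul_assoc, smul_eq_mul, mul_add, ins_nil,
      smul_add, mul_smul_comm]
    abel

theorem hd₂_mul : hd₂ η (f * g) z w =
    f [] • hd₂ η g z w + hd₂ η f z w * g + tw η (hd f z) * ins η g w := by
  have h : tw η (hd f z) = csum fun K => η ^ K.length • tw η (D (z K) f) := by
    ext L
    simp only [tw, hd, csum, Finset.smul_sum]
    refine Finset.sum_congr rfl fun k hk => ?_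
    have : L.length = (L.take k).length + (L.drop k).length := by
      rw [← List.length_append, List.take_append_drop]
    rw [this, pow_add]
    simp [mul_smul, tw]
  rw [h]
  simp only [hd₂, D_mul, ins_add, ins_smul, ins_mul, csum_mul, ← csum_smul, ← csum_add]
  congr 1
  funext K
  rw [smul_add, smul_add, smul_mul_assoc, smul_mul_assoc, add_assoc]
  congr 1
  ext L
  simp

@[simp] theorem hd₂_add : hd₂ η (f + g) z w = hd₂ η f z w + hd₂ η g z w := by
  simp [hd₂, csum_add]

@[simp] theorem hd₂_smul {S : Type*} [Ring S] [Module S R] [SMulCommClass S ℝ R] (s : S) :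
    hd₂ η (s • f) z w = s • hd₂ η f z w := by
  simp only [hd₂, D_smul, ins_smul, ← csum_smul]
  congr 1; funext K; ext L; simp [smul_comm s]

@[simp] theorem ins₂_nil : ins₂ ε η f z w [] = hd₂ η f z w [] := rfl
@[simp] theorem ins₂_cons (a : A) (L : List A) : ins₂ ε η f z w (a :: L) =
    hd₂ η f z w (a :: L) + (ε * η) • ins₂ ε η (D a f) z w L := rfl
@[simp] theorem D_ins₂ (a : A) : D a (ins₂ ε η f z w) =
    D a (hd₂ η f z w) + (ε * η) • ins₂ ε η (D a f) z w := rfl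

@[simp] theorem ins₂_add : ins₂ ε η (f + g) z w = ins₂ ε η f z w + ins₂ ε η g z w := by
  ext L
  induction L generalizing f g with
  | nil => simp
  | cons a L ih => simp [ih]; abel

@[simp] theorem ins₂_smul {S : Type*} [Ring S] [Module S R] [SMulCommClass S ℝ R] (s : S) :
    ins₂ ε η (s • f) z w = s • ins₂ ε η f z w := by
  ext L
  induction L generalizing f with
  | nil => simp
  | cons a L ih => simp [ih, smul_comm s]

@[simp] theorem ins₂_neg : ins₂ ε η (-f) z w = -ins₂ ε η f z w := by
  rw [← neg_one_smul ℝ f, ins₂_smul, neg_one_smul]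

@[simp] theorem ins₂_sub : ins₂ ε η (f - g) z w = ins₂ ε η f z w - ins₂ ε η g z w := by
  rw [sub_eq_add_neg, ins₂_add, ins₂_neg, sub_eq_add_neg]

/-- The Leibniz rule for the insertion of two cochains into a convolution product. -/
theorem ins₂_mul : ins₂ ε η (f * g) z w = ins₂ ε η f z w * g
    + tw η (ins ε f z) * ins η g w + tw (ε * η) f * ins₂ ε η g z w := by
  ext L
  induction L generalizing f g with
  | nil => simp [hd₂_mul]; abel
  | cons a L ih =>
    simp only [ins₂_cons, hd₂_mul, D_mul, ins₂_add, ins₂_smul, add_apply, smul_apply, ih, mul_cons,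
      D_ins, D_ins₂, D_tw, tw_nil, tw_add, tw_smul, add_mul, smul_mul_assoc,
      smul_eq_mul, mul_add, ins_nil, ins₂_nil, smul_add, mul_smul_comm, ins_cons, smul_smul,
      mul_comm η ε]
    abel

/-- Application of a linear map to the values of a function on words. -/
def map (T : R →ₗ[ℝ] R') (f : Conv A R) : Conv A R' := fun L => T (f L)

@[simp] theorem map_apply (T : R →ₗ[ℝ] R') (f : Conv A R) (L : List A) : map T f L = T (f L) := rfl
@[simp] theorem D_map (T : R →ₗ[ℝ] R') (f : Conv A R) (a : A) : D a (map T f) = map T (D a f) := rfl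

theorem tw_map (T : R →ₗ[ℝ] R') : tw ε (map T f) = map T (tw ε f) := by
  ext L; simp [tw]

theorem hd_map (T : R →ₗ[ℝ] R') : hd (map T f) z = map T (hd f z) := by
  ext L; simp [hd, csum, map_sum]

/-- Insertion commutes with linear maps of the values. -/
theorem ins_map (T : R →ₗ[ℝ] R') : ins ε (map T f) z = map T (ins ε f z) := by
  ext L
  induction L generalizing f with
  | nil => simp [hd_map]
  | cons a L ih => simp [hd_map, ih]

theorem hd₂_map (T : R →ₗ[ℝ] R') : hd₂ η (map T f) z w = map T (hd₂ η f z w) := by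
  ext L; simp [hd₂, csum, map_sum, ins_map]

theorem ins₂_map (T : R →ₗ[ℝ] R') : ins₂ ε η (map T f) z w = map T (ins₂ ε η f z w) := by
  ext L
  induction L generalizing f with
  | nil => simp [hd₂_map]
  | cons a L ih => simp [hd₂_map, ih]

end Conv

end Conv

/-! ### Universal words and multilinear cochains -/

section Brace

set_option linter.unusedSectionVars false

namespace Conv

section Word

variable {A T : Type*} [CommRing A] [Algebra ℝ A] [Ring T] [Algebra ℝ T]

/-- The function on words `a₁…aₙ ↦ ι a₁ ⋯ ι aₙ`. -/
def word (ι : A →ₗ[ℝ] T) : Conv A T := fun L => (L.map ι).prod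

variable (ι : A →ₗ[ℝ] T) (ε η : ℝ) (y z w : Conv A A)

@[simp] theorem word_nil : word ι [] = 1 := rfl
@[simp] theorem word_cons (a : A) (L : List A) : word ι (a :: L) = ι a * word ι L := rfl
@[simp] theorem D_word (a : A) : D a (word ι) = ι a • word ι := rfl

theorem tw_smul' (t : T) (f : Conv A T) : tw η (t • f) = t • tw η f := by
  ext L; simp [tw_apply]

theorem tw_word : tw η (word ι) = word (η • ι) := by
  ext L
  induction L with
  | nil => simp
  | cons a L ih => rw [tw_cons, D_word, tw_smul', smul_apply, ih]; simp

theorem hd_word : hd (word ι) z = map ι z * word ι := rfl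

/-- Insertion into a word cuts the word at the place of the
insertion.  All identities between insertions reduce to this formula and the Leibniz rules. -/
theorem ins_word : ins ε (word ι) z = tw ε (word ι) * map ι z * word ι := by
  rw [mul_assoc]
  ext L
  induction L with
  | nil => simp [hd_word]
  | cons a L ih =>
    rw [ins_cons, mul_cons, D_word, ins_smul, smul_apply, ih, D_tw, D_word, tw_nil, word_nil,
      one_mul, hd_word, smul_mul_assoc, smul_apply, tw_smul', smul_mul_left, smul_apply]

theorem hd₂_word : hd₂ η (word ι) z w =
    tw η (map ι z) * (tw η (word ι) * map ι w * word ι) := by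
  rw [← ins_word]
  simp only [hd₂, mul_def, D_word, ins_smul]
  congr 1; funext K; ext L; simp [tw_apply]

theorem ins₂_word : ins₂ ε η (word ι) z w = tw (ε * η) (word ι) * tw η (map ι z) *
    tw η (word ι) * map ι w * word ι := by
  rw [mul_assoc, mul_assoc, mul_assoc, ← mul_assoc (tw η (word ι)), ← hd₂_word]
  ext L
  induction L with
  | nil => simp
  | cons a L ih =>
    rw [ins₂_cons, mul_cons, D_word, ins₂_smul, smul_apply, ih, D_tw, D_word, tw_nil, word_nil,
      one_mul, smul_mul_assoc, smul_apply, tw_smul', smul_mul_left, smul_apply]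

theorem map_smul_left (s : ℝ) : map (s • ι) z = s • map ι z := rfl

theorem ins_tw_word : ins ε (tw η (word ι)) z =
    η • (tw (ε * η) (word ι) * map ι z * tw η (word ι)) := by
  rw [tw_word, ins_word, map_smul_left, ← tw_word, tw_tw]
  simp

theorem ins₂_tw_word (ζ : ℝ) (h : ζ * ζ = 1) : ins₂ ε η (tw ζ (word ι)) z w =
    tw (ε * η * ζ) (word ι) * tw η (map ι z) * tw (η * ζ) (word ι) * map ι w * tw ζ (word ι) := by
  rw [tw_word, ins₂_word, map_smul_left, map_smul_left, ← tw_word, tw_tw, tw_tw, tw_smul]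
  simp [smul_smul, h]

end Word

section Multilinear

variable {A : Type*} [CommRing A] [Algebra ℝ A]

variable (A) in
/-- The functions on words that are linear in every letter. -/
def ML : Submodule ℝ (Conv A A) where
  carrier := {φ | ∀ (K L : List A) (a b : A) (s t : ℝ),
      φ (K ++ (s • a + t • b) :: L) = s • φ (K ++ a :: L) + t • φ (K ++ b :: L)}
  zero_mem' := by simp
  add_mem' := by
    intro φ ψ h₁ h₂ K L a b s t
    simp only [add_apply, h₁ K, h₂ K, smul_add]; abel
  smul_mem' := by
    intro c φ h K L a b s t
    simp only [smul_apply, h K, smul_add, smul_comm c]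

theorem D_mem_ML {x : Conv A A} (hx : x ∈ ML A) (a : A) : D a x ∈ ML A :=
  fun K L b c s t => hx (a :: K) L b c s t

variable (A) in
/-- The letter `a` as the operator of differentiation by `a` on multilinear functions on words. The
opposite algebra is used because the derivative by a word applies its first letter first. -/
def letter : A →ₗ[ℝ] (Module.End ℝ (ML A))ᵐᵒᵖ where
  toFun a := .op
    { toFun x := ⟨D a x, D_mem_ML x.2 a⟩
      map_add' _ _ := rfl
      map_smul' _ _ := rfl }
  map_add' a b := by
    refine MulOpposite.unop_injective (LinearMap.ext fun x => Subtype.ext (Conv.ext fun L => ?_))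
    have h := x.2 [] L a b 1 1
    rwa [one_smul, one_smul, one_smul, one_smul] at h
  map_smul' s a := by
    refine MulOpposite.unop_injective (LinearMap.ext fun x => Subtype.ext (Conv.ext fun L => ?_))
    have h := x.2 [] L a a s 0
    rwa [zero_smul, zero_smul, add_zero, add_zero] at h

/-- Evaluation of an operator at a multilinear function, followed by evaluation at the empty
word. -/
def ev (x : ML A) : (Module.End ℝ (ML A))ᵐᵒᵖ →ₗ[ℝ] A where
  toFun t := (t.unop x).1 []
  map_add' _ _ := rfl
  map_smul' _ _ := rfl

/-- Every multilinear function on words factors through the universal one. -/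
theorem map_ev (x : ML A) : map (ev x) (word (letter A)) = x := by
  ext L
  induction L generalizing x with
  | nil => rfl
  | cons a L ih => exact ih ⟨D a x, D_mem_ML x.2 a⟩

theorem ins_eq_map (ε : ℝ) (x : ML A) (z : Conv A A) :
    ins ε x.1 z = map (ev x) (ins ε (word (letter A)) z) := by
  rw [← ins_map, map_ev]

theorem ins₂_eq_map (ε η : ℝ) (x : ML A) (z w : Conv A A) :
    ins₂ ε η x.1 z w = map (ev x) (ins₂ ε η (word (letter A)) z w) := by
  rw [← ins₂_map, map_ev]

section

variable {A R R' : Type*} [Ring R] [Algebra ℝ R] [Ring R'] [Algebra ℝ R'] (T : R →ₗ[ℝ] R')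
  (f g : Conv A R)

@[simp] theorem map_add : map T (f + g) = map T f + map T g := by ext L; simp
@[simp] theorem map_sub : map T (f - g) = map T f - map T g := by ext L; simp
@[simp] theorem map_neg : map T (-f) = -map T f := by ext L; simp
@[simp] theorem map_smul (s : ℝ) : map T (s • f) = s • map T f := by ext L; simp

end

theorem ins_add_right (ε : ℝ) {x : Conv A A} (hx : x ∈ ML A) (z w : Conv A A) :
    ins ε x (z + w) = ins ε x z + ins ε x w := by
  simp only [ins_eq_map ε ⟨x, hx⟩, ins_word, map_add, mul_add, add_mul]

theorem ins_smul_right (ε s : ℝ) {x : Conv A A} (hx : x ∈ ML A) (z : Conv A A) :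
    ins ε x (s • z) = s • ins ε x z := by
  simp only [ins_eq_map ε ⟨x, hx⟩, ins_word, map_smul, mul_smul_comm, smul_mul_assoc]

theorem ins_neg_right (ε : ℝ) {x : Conv A A} (hx : x ∈ ML A) (z : Conv A A) :
    ins ε x (-z) = -ins ε x z := by
  rw [← neg_one_smul ℝ z, ins_smul_right ε _ hx, neg_one_smul]

theorem ins_sub_right (ε : ℝ) {x : Conv A A} (hx : x ∈ ML A) (z w : Conv A A) :
    ins ε x (z - w) = ins ε x z - ins ε x w := by
  rw [sub_eq_add_neg, ins_add_right ε hx, ins_neg_right ε hx, sub_eq_add_neg]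

end Multilinear

/-! ### Parity and the pre-Lie identity -/

section PreLie

variable {A : Type*} [CommRing A] [Algebra ℝ A]

/-- `z` lives on words of even length if `ε = -1` and on words of odd length if `ε = 1`; that is,
`ε` is the sign `(-1)^(m-1)` for all degrees `m` in which `z` is nonzero. -/
structure Par (ε : ℝ) (z : Conv A A) : Prop where
  sign : ε = 1 ∨ ε = -1
  tw_eq : tw (-1) z = (-ε) • z

/-- The Koszul sign `(-1)^((k-1)(l-1))` as a function of `ε = (-1)^(k-1)` and `η = (-1)^(l-1)`. -/
noncomputable def koszul (ε η : ℝ) : ℝ := (1 + ε + η - ε * η) / 2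

@[simp] theorem koszul_one_left (ε : ℝ) : koszul 1 ε = 1 := by unfold koszul; ring
@[simp] theorem koszul_one_right (ε : ℝ) : koszul ε 1 = 1 := by unfold koszul; ring
@[simp] theorem koszul_neg_neg : koszul (-1) (-1) = -1 := by unfold koszul; ring

theorem Par.tw_map {T : Type*} [Ring T] [Algebra ℝ T] (ι : A →ₗ[ℝ] T) {ε : ℝ} {z : Conv A A}
    (hz : Par ε z) : tw (-1) (map ι z) = (-ε) • map ι z := by
  rw [Conv.tw_map, hz.tw_eq, map_smul]

/-- The pre-Lie identity for insertions into a word, where it becomes an identity in the convolution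
algebra: both associators count the ways of inserting `y` and `z` at disjoint places. -/
theorem preLie_word {T : Type*} [Ring T] [Algebra ℝ T] (ι : A →ₗ[ℝ] T) {ε η : ℝ} {y z : Conv A A}
    (hy : Par η y) (hz : Par ε z) :
    ins ε (ins η (word ι) y) z - ins (ε * η) (word ι) (ins ε y z) =
      koszul ε η • (ins η (ins ε (word ι) z) y - ins (ε * η) (word ι) (ins η z y)) := by
  have hy' := hy.tw_map ι
  have hz' := hz.tw_map ι
  rcases hy.sign with rfl | rfl <;> rcases hz.sign with rfl | rfl <;>
  · simp [ins_word, ins_mul, ins_map, ins_tw_word, tw_mul, tw_tw, hy', hz']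
    try noncomm_ring

/-- Gerstenhaber's pre-Lie identity: the associator of the insertion product is graded symmetric in
its last two arguments. -/
theorem preLie {ε η : ℝ} {x y z : Conv A A} (hx : x ∈ ML A) (hy : Par η y) (hz : Par ε z) :
    ins ε (ins η x y) z - ins (ε * η) x (ins ε y z) =
      koszul ε η • (ins η (ins ε x z) y - ins (ε * η) x (ins η z y)) := by
  simp only [ins_eq_map _ ⟨x, hx⟩, ins_map, ← map_sub, ← map_smul, preLie_word _ hy hz]

end PreLie

end Conv

end Brace

/-! ### The Hochschild differential in terms of insertions -/

section Differential

set_option linter.unusedSectionVars false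

namespace Conv

variable {A : Type*} [CommRing A] [Algebra ℝ A]

variable (A) in
/-- The identity of `A` as a `1`-cochain. -/
def lett : Conv A A
  | [a] => a
  | _ => 0

@[simp] theorem lett_nil : lett A [] = 0 := rfl

@[simp] theorem D_lett (a : A) : D a (lett A) = a • (1 : Conv A A) := by
  ext L; cases L <;> simp [lett]

theorem hd_one (z : Conv A A) : hd (1 : Conv A A) z = 0 := by
  ext L; simp [hd, csum]

theorem ins_one (ε : ℝ) (z : Conv A A) : ins ε (1 : Conv A A) z = 0 := by
  ext L
  induction L with
  | nil => simp [hd_one]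
  | cons a L ih =>
    rw [ins_cons, hd_one, show D a (1 : Conv A A) = (0 : ℝ) • (1 : Conv A A) by ext L; simp,
      ins_smul]
    simp

theorem hd_lett (z : Conv A A) : hd (lett A) z = z := by
  simp only [hd, D_lett]
  exact mul_one z

@[simp] theorem ins_lett (ε : ℝ) (z : Conv A A) : ins ε (lett A) z = z := by
  ext L
  cases L <;> simp [hd_lett, ins_one]

@[simp] theorem ins₂_lett (ε η : ℝ) (z w : Conv A A) : ins₂ ε η (lett A) z w = 0 := by
  have h : hd₂ η (lett A) z w = 0 := by
    ext L; simp [hd₂, csum, ins_one]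
  have h0 (a : A) : D a (1 : Conv A A) = (0 : ℝ) • (1 : Conv A A) := by ext L; simp
  have h1 (L : List A) : ins₂ ε η (1 : Conv A A) z w L = 0 := by
    have h : hd₂ η (1 : Conv A A) z w = 0 := by
      ext L; simp only [hd₂, csum, h0, ins_smul]; simp
    induction L with
    | nil => simp [h]
    | cons a L ih => rw [ins₂_cons, h, h0, ins₂_smul, smul_apply, ih]; simp
  ext L
  cases L <;> simp [h, h1]

@[simp] theorem tw_lett (ε : ℝ) : tw ε (lett A) = ε • lett A := by
  ext L
  match L with
  | [] => simp
  | [a] => simp [tw_apply]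
  | a :: b :: L => simp [tw_apply, lett]

/-- The Hochschild differential, written with the cup product and the insertion product.  The
product of `A`, as a `2`-cochain, is the cup square of the identity cochain. -/
noncomputable def dif (φ : Conv A A) : Conv A A :=
  lett A * φ - tw (-1) φ * lett A - ins (-1) φ (lett A * lett A)

/-- The differential is a derivation of the cup product. -/
theorem dif_mul (φ ψ : Conv A A) : dif (φ * ψ) = dif φ * ψ + tw (-1) φ * dif ψ := by
  simp only [dif, ins_mul, tw_mul]
  noncomm_ring

theorem tw_ins (ε η : ℝ) (hη : η * η = 1) {x : Conv A A} (hx : x ∈ ML A) (z : Conv A A) :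
    tw η (ins ε x z) = η • ins ε (tw η x) (tw η z) := by
  rw [show x = map (ev ⟨x, hx⟩) (word (letter A)) from (map_ev ⟨x, hx⟩).symm,
    ins_map, tw_map, tw_map, ins_map, ← map_smul, ins_tw_word, ins_word,
    smul_smul, hη, one_smul, tw_mul, tw_mul, tw_tw, tw_map, mul_comm η]

theorem tw_ins₂ (ε η ζ : ℝ) (hζ : ζ * ζ = 1) {x : Conv A A} (hx : x ∈ ML A) (z w : Conv A A) :
    tw ζ (ins₂ ε η x z w) = ins₂ ε η (tw ζ x) (tw ζ z) (tw ζ w) := by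
  rw [show x = map (ev ⟨x, hx⟩) (word (letter A)) from (map_ev ⟨x, hx⟩).symm,
    ins₂_map, tw_map, tw_map, ins₂_map, ins₂_tw_word _ _ _ _ _ _ hζ, ins₂_word]
  simp only [tw_mul, tw_tw, tw_map, mul_comm ζ]

theorem ins₂_smul_middle (ε η s : ℝ) {x : Conv A A} (hx : x ∈ ML A) (z w : Conv A A) :
    ins₂ ε η x (s • z) w = s • ins₂ ε η x z w := by
  simp only [ins₂_eq_map _ _ ⟨x, hx⟩, ins₂_word, map_smul, tw_smul, mul_smul_comm, smul_mul_assoc]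

theorem ins₂_smul_right (ε η s : ℝ) {x : Conv A A} (hx : x ∈ ML A) (z w : Conv A A) :
    ins₂ ε η x z (s • w) = s • ins₂ ε η x z w := by
  simp only [ins₂_eq_map _ _ ⟨x, hx⟩, ins₂_word, map_smul, mul_smul_comm, smul_mul_assoc]

theorem Par.mul {ε η : ℝ} {φ ψ : Conv A A} (hφ : Par ε φ) (hψ : Par η ψ) :
    Par (-(ε * η)) (φ * ψ) := by
  refine ⟨by rcases hφ.sign with rfl | rfl <;> rcases hψ.sign with rfl | rfl <;> simp, ?_⟩
  rw [tw_mul, hφ.tw_eq, hψ.tw_eq, smul_mul_assoc, mul_smul_comm, smul_smul]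
  congr 1; ring

theorem Par.ins {ε η : ℝ} {φ ψ : Conv A A} (hx : φ ∈ ML A) (hφ : Par ε φ) (hψ : Par η ψ) :
    Par (ε * η) (ins η φ ψ) := by
  refine ⟨by rcases hφ.sign with rfl | rfl <;> rcases hψ.sign with rfl | rfl <;> simp, ?_⟩
  rw [tw_ins _ _ (by norm_num) hx, hφ.tw_eq, hψ.tw_eq, ins_smul, ins_smul_right _ _ hx, smul_smul,
    smul_smul]
  congr 1; ring

theorem par_lett : Par 1 (lett A) := ⟨.inl rfl, tw_lett _⟩

theorem par_lett_mul : Par (-1) (lett A * lett A) := by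
  simpa using (par_lett (A := A)).mul par_lett

/-- The insertion product as a homotopy: up to terms that vanish on cocycles, its boundary is the
graded commutator of the cup product. -/
theorem dif_ins {ε η : ℝ} {x y : Conv A A} (hx : x ∈ ML A) (hε : Par ε x) (hη : Par η y) :
    dif (ins η x y) = ins (-η) x (dif y) + η • ins η (dif x) y - η • (y * x)
      - (ε * η) • (tw η x * y) := by
  have h := preLie hx hη par_lett_mul
  have h1 := (Par.ins hx hε hη).tw_eq
  rw [sub_eq_iff_eq_add] at h
  rw [dif, h, h1]
  simp only [dif, ins_sub_right _ hx, ins_sub, ins_mul, ins_lett, hη.tw_eq, hε.tw_eq,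
    ins_smul, ins_add_right _ hx, ins_smul_right _ _ hx, tw_lett, smul_mul_assoc]
  rcases hη.sign with rfl | rfl <;> rcases hε.sign with rfl | rfl <;>
  · simp [hε.tw_eq]
    try abel

/-- Insertion of the product of `A` into a brace of a word with two cocycles. -/
theorem ins_ins₂_word {T : Type*} [Ring T] [Algebra ℝ T] (ι : A →ₗ[ℝ] T) {ε η : ℝ}
    {φ ψ : Conv A A} (hφ : Par ε φ) (hψ : Par η ψ) (dφ : dif φ = 0) (dψ : dif ψ = 0) :
    ins (-1) (ins₂ ε η (word ι) φ ψ) (lett A * lett A) =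
      (ε * η) • (ins₂ ε η (ins (-1) (word ι) (lett A * lett A)) φ ψ
        - ins (-(ε * η)) (word ι) (tw η φ * ψ)) := by
  have hφ' := hφ.tw_map ι
  have hψ' := hψ.tw_map ι
  have dφ' : ins (-1) φ (lett A * lett A) = lett A * φ - tw (-1) φ * lett A := by
    rw [dif, sub_eq_zero] at dφ; exact dφ.symm
  have dψ' : ins (-1) ψ (lett A * lett A) = lett A * ψ - tw (-1) ψ * lett A := by
    rw [dif, sub_eq_zero] at dψ; exact dψ.symm
  rw [hφ.tw_eq] at dφ'
  rw [hψ.tw_eq] at dψ'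
  rcases hφ.sign with rfl | rfl <;> rcases hψ.sign with rfl | rfl <;>
  · simp [ins_word, ins_mul, ins_map, ins_tw_word, tw_mul, tw_tw, hφ', hψ', ins₂_word, ins₂_mul,
      ins₂_map, ins₂_tw_word, tw_map, hφ.tw_eq, dφ', dψ']
    try noncomm_ring

/-- The brace as a homotopy: its boundary measures how far the insertion product fails to be a
derivation of the cup product in its second argument. -/
theorem dif_ins₂ {ε η ζ : ℝ} {χ φ ψ : Conv A A} (hx : χ ∈ ML A) (hχ : Par ζ χ) (hφ : Par ε φ)
    (hψ : Par η ψ) (dχ : dif χ = 0) (dφ : dif φ = 0) (dψ : dif ψ = 0) :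
    dif (ins₂ ε η χ φ ψ) = (ε * η) • (ins (-(ε * η)) χ (tw η φ * ψ) - tw η φ * ins η χ ψ
      - ζ • (tw η (ins ε χ φ) * ψ)) := by
  have h : ins (-1) (ins₂ ε η χ φ ψ) (lett A * lett A) =
      (ε * η) • (ins₂ ε η (ins (-1) χ (lett A * lett A)) φ ψ
        - ins (-(ε * η)) χ (tw η φ * ψ)) := by
    simp only [ins₂_eq_map _ _ ⟨χ, hx⟩, ins_eq_map _ ⟨χ, hx⟩, ins_map, ins₂_map, ← map_sub,
      ← map_smul, ins_ins₂_word _ hφ hψ dφ dψ]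
  have dχ' : ins (-1) χ (lett A * lett A) = lett A * χ - tw (-1) χ * lett A := by
    rw [dif, sub_eq_zero] at dχ; exact dχ.symm
  rw [dif, h, dχ', tw_ins₂ _ _ _ (by norm_num) hx, hχ.tw_eq, hφ.tw_eq, hψ.tw_eq]
  simp only [ins₂_sub, ins₂_mul, ins₂_smul, ins₂_smul_middle _ _ _ hx, ins₂_smul_right _ _ _ hx,
    ins₂_lett, ins_lett, smul_mul_assoc, tw_lett]
  rcases hφ.sign with rfl | rfl <;> rcases hψ.sign with rfl | rfl <;>
  · simp
    try abel

end Conv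

end Differential

/-! ### Comparison with the explicit formulas -/

section Comparison

set_option linter.unusedSectionVars false

open Conv

variable {A : Type*} [CommRing A] [Algebra ℝ A]

theorem unitCochain_eq_one : (unitCochain : Cochain A) = (1 : Conv A A) := by
  funext L; cases L <;> simp [unitCochain]

theorem ML_zero {φ : Conv A A} (h : φ ∈ ML A) (K L : List A) : φ (K ++ 0 :: L) = 0 := by
  simpa using h K L 0 0 0 0

@[simp] theorem D_one (a : A) : D a (1 : Conv A A) = 0 := by ext L; simp

@[simp] theorem lett_singleton (a : A) : lett A [a] = a := rfl

theorem lett_mul_lett_nil : (lett A * lett A) [] = 0 := by simp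

theorem lett_mul_lett_one (a : A) : (lett A * lett A) [a] = 0 := by simp

theorem lett_mul_lett_two (a b : A) : (lett A * lett A) [a, b] = a * b := by
  simp

theorem lett_mul_lett_three (a b c : A) (L : List A) :
    (lett A * lett A) (a :: b :: c :: L) = 0 := by
  simp [lett, show D c (0 : Conv A A) = 0 from rfl]

theorem hd_mul_lett {φ : Conv A A} (h : φ ∈ ML A) (a b : A) (L : List A) :
    hd φ (lett A * lett A) (a :: b :: L) = φ (a * b :: L) := by
  rw [hd, csum_cons, csum_cons, lett_mul_lett_nil]
  have h0 (L : List A) : φ (0 :: L) = 0 := ML_zero h [] L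
  have h3 (c : A) (L : List A) : (lett A * lett A) (a :: b :: c :: L) = 0 :=
    lett_mul_lett_three a b c L
  cases L with
  | nil => rw [csum_nil, lett_mul_lett_one, lett_mul_lett_two]; simp [h0]
  | cons c L =>
    rw [csum_cons, lett_mul_lett_one, lett_mul_lett_two]
    simp only [csum, h3, D_apply, h0, Finset.sum_const_zero]
    simp

theorem hd_lett_mul_lett_of_length {φ : Conv A A} (h : φ ∈ ML A) {L : List A} (hL : L.length < 2) :
    hd φ (lett A * lett A) L = 0 := by
  have h0 (L : List A) : φ (0 :: L) = 0 := ML_zero h [] L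
  match L with
  | [] => simp [hd, h0]
  | [a] => simp [hd, h0]
  | a :: b :: L => simp at hL

theorem ins_lett_mul_lett {φ : Conv A A} (h : φ ∈ ML A) (a : A) (T : List A) :
    ins (-1) φ (lett A * lett A) (a :: T) = -∑ i ∈ Finset.range T.length, (-1) ^ (i + 1) *
      φ ((a :: T).take i ++ (((a :: T).drop i).take 2).prod :: (a :: T).drop (i + 2)) := by
  induction T generalizing φ a with
  | nil => simp [hd_lett_mul_lett_of_length h, hd_lett_mul_lett_of_length (D_mem_ML h a)]
  | cons b T ih =>
    rw [ins_cons, ih (D_mem_ML h a), hd_mul_lett h, List.length_cons, Finset.sum_range_succ']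
    simp only [pow_succ _ (_ + 1)]
    simp [add_comm]

theorem mul_lett_cons (φ : Conv A A) (a : A) (T : List A) :
    (φ * lett A) (a :: T) = φ (a :: T).dropLast * (a :: T).getLast (List.cons_ne_nil a T) := by
  induction T generalizing φ a with
  | nil => simp [lett]
  | cons b T ih =>
    rw [mul_cons, ih]
    simp [lett]

theorem lett_mul_cons (φ : Conv A A) (a : A) (T : List A) : (lett A * φ) (a :: T) = a * φ T := by
  simp [smul_mul_left]

/-- On multilinear cochains `dif` is the Hochschild differential. -/
theorem hochschild_eq_dif {φ : Conv A A} (h : φ ∈ ML A) : hochschild A φ = dif φ := by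
  funext L
  cases L with
  | nil => simp [hochschild, hochschildFun, dif, hd_lett_mul_lett_of_length h]
  | cons a T =>
    have e : hochschild A φ (a :: T) = a * φ T
        + ∑ i ∈ Finset.range T.length, (-1) ^ (i + 1) *
          φ ((a :: T).take i ++ (((a :: T).drop i).take 2).prod :: (a :: T).drop (i + 2))
        + (-1) ^ (T.length + 1) *
          (φ (a :: T).dropLast * (a :: T).getLast (List.cons_ne_nil a T)) := rfl
    rw [e, dif, Conv.sub_apply, Conv.sub_apply, ins_lett_mul_lett h, lett_mul_cons,
      mul_lett_cons, tw_apply]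
    simp [pow_succ, Algebra.smul_def]
    ring

theorem hochschildFun_congr {φ ψ : Cochain A} {n : ℕ} (h : ∀ L : List A, L.length = n → φ L = ψ L)
    {L : List A} (hL : L.length = n + 1) : hochschildFun φ L = hochschildFun ψ L := by
  cases L with
  | nil => simp at hL
  | cons a T =>
    simp only [List.length_cons, Nat.add_right_cancel_iff] at hL
    simp only [hochschildFun]
    rw [h T hL, h (a :: T).dropLast (by simp [hL])]
    congr 2
    refine Finset.sum_congr rfl fun i hi => ?_
    rw [h]
    simp only [Finset.mem_range] at hi
    simp only [List.length_append, List.length_take, List.length_cons, List.length_drop]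
    omega

theorem ins_eq_sum (ε : ℝ) (φ ψ : Conv A A) (L : List A) : ins ε φ ψ L =
    ∑ i ∈ Finset.range (L.length + 1), ∑ l ∈ Finset.range (L.length - i + 1),
      ε ^ i • φ (L.take i ++ ψ ((L.drop i).take l) :: L.drop (i + l)) := by
  induction L generalizing φ with
  | nil => simp [hd, csum]
  | cons a L ih =>
    rw [ins_cons, ih, List.length_cons, Finset.sum_range_succ' _ (L.length + 1), add_comm]
    congr 1
    · simp only [Finset.smul_sum]
      refine Finset.sum_congr rfl fun i hi => ?_
      rw [show L.length + 1 - (i + 1) = L.length - i by omega]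
      refine Finset.sum_congr rfl fun l hl => ?_
      rw [show i + 1 + l = (i + l) + 1 by omega]
      simp [pow_succ', mul_smul]
    · simp [hd, csum, D]

/-- Insertions of values `0` do not contribute by multilinearity, so that for homogeneous `ψ` all
signs in `circ` are powers of one sign. -/
theorem circ_eq_ins {φ ψ : Conv A A} (hφ : φ ∈ ML A) {l : ℕ} (hψ : IsHomog l ψ) :
    circ φ ψ = ins ((-1) ^ (l + 1)) φ ψ := by
  funext L
  rw [ins_eq_sum]
  unfold circ
  rw [Finset.sum_comm' (t' := Finset.range (L.length + 1))
    (s' := fun i => Finset.range (L.length - i + 1)) (by intro x y; simp; omega)]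
  refine Finset.sum_congr rfl fun i hi => Finset.sum_congr rfl fun m hm => ?_
  simp only [Finset.mem_range] at hi hm
  by_cases h : m = l
  · subst h
    rw [Algebra.smul_def, ← pow_mul, mul_comm i]
    simp
  · rw [hψ _ (by simp; omega), ML_zero hφ]
    simp

theorem IsHomog.smul_tw {k : ℤ} {φ : Conv A A} (h : IsHomog k φ) :
    tw (-1) φ = ((k.negOnePow : ℤ) : ℝ) • φ := by
  ext L
  by_cases hL : (L.length : ℤ) = k
  · rw [tw_apply, Conv.smul_apply, ← hL]
    simp
  · simp [tw_apply, h L hL]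

/-- The sign `(-1)^k` as a real number. -/
def sg (k : ℤ) : ℝ := ((k.negOnePow : ℤ) : ℝ)

theorem sg_eq (k : ℤ) : sg k = 1 ∨ sg k = -1 := by
  rcases Int.even_or_odd k with h | h <;> simp [sg, Int.negOnePow_even, Int.negOnePow_odd, h]

theorem sg_add_one (k : ℤ) : sg (k + 1) = -sg k := by simp [sg, Int.negOnePow_succ]

theorem sg_sub_one (k : ℤ) : sg (k - 1) = -sg k := by
  rw [← neg_eq_iff_eq_neg, ← sg_add_one]; simp

theorem sg_mul (k l : ℤ) : sg (k * l) = koszul (sg k) (sg l) := by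
  rcases Int.even_or_odd k with h | h <;> rcases Int.even_or_odd l with h' | h' <;>
    simp [sg, Int.negOnePow_even, Int.negOnePow_odd, h, h']

theorem negOnePow_smul {V : Type*} [AddCommGroup V] [Module ℝ V] (k : ℤ) (v : V) :
    k.negOnePow • v = sg k • v := by
  rcases Int.even_or_odd k with h | h <;> simp [sg, Int.negOnePow_even, Int.negOnePow_odd, h]

theorem IsHomog.par {k : ℤ} {φ : Conv A A} (h : IsHomog k φ) : Par (sg (k - 1)) φ :=
  ⟨sg_eq _, by rw [h.smul_tw, sg_sub_one, neg_neg]; rfl⟩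

theorem sg_natCast_sub_one (k : ℕ) : sg (k - 1) = (-1) ^ (k + 1) := by
  rw [sg_sub_one, pow_succ]; simp [sg]

theorem koszul_neg_one_pow (k l : ℕ) :
    koszul ((-1) ^ (k + 1)) ((-1) ^ (l + 1)) = (-1) ^ ((k + 1) * (l + 1)) := by
  have h (n : ℕ) : ((-1 : ℝ)) ^ n = sg n := by simp [sg]
  rw [h, h, h, ← sg_mul]
  push_cast
  rfl

end Comparison

/-! ### The bracket of cochains -/

section Bracket

set_option linter.unusedSectionVars false

namespace Conv

variable {A : Type*} [CommRing A] [Algebra ℝ A]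

/-- The Gerstenhaber bracket of cochains of parities `ε` and `η`. -/
noncomputable def br (ε η : ℝ) (φ ψ : Conv A A) : Conv A A :=
  ins η φ ψ - koszul ε η • ins ε ψ φ

theorem gBracket_eq_br {φ ψ : Conv A A} (hφ : φ ∈ ML A) (hψ : ψ ∈ ML A) {k l : ℕ}
    (h : IsHomog k φ) (h' : IsHomog l ψ) :
    gBracket k l φ ψ = br ((-1) ^ (k + 1)) ((-1) ^ (l + 1)) φ ψ := by
  unfold gBracket
  rw [circ_eq_ins hφ h', circ_eq_ins hψ h, br, koszul_neg_one_pow]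
  rfl

section

variable {ε η ζ : ℝ} {φ ψ χ θ : Conv A A}

theorem ins_zero_left (ε : ℝ) (z : Conv A A) : ins ε (0 : Conv A A) z = 0 := by
  simpa using ins_smul ε (0 : Conv A A) z (0 : ℝ)

theorem ins_zero_right (ε : ℝ) {x : Conv A A} (hx : x ∈ ML A) : ins ε x 0 = 0 := by
  simpa using ins_smul_right ε 0 hx 0

theorem dif_add (φ ψ : Conv A A) : dif (φ + ψ) = dif φ + dif ψ := by
  simp only [dif, tw_add, ins_add]; noncomm_ring

theorem dif_smul (s : ℝ) (φ : Conv A A) : dif (s • φ) = s • dif φ := by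
  simp only [dif, tw_smul, ins_smul, mul_smul_comm, smul_mul_assoc, smul_sub]

theorem dif_sub (φ ψ : Conv A A) : dif (φ - ψ) = dif φ - dif ψ := by
  rw [sub_eq_add_neg, ← neg_one_smul ℝ ψ, dif_add, dif_smul, neg_one_smul, ← sub_eq_add_neg]

theorem Par.smul (h : Par ε φ) (s : ℝ) : Par ε (s • φ) :=
  ⟨h.sign, by rw [tw_smul, h.tw_eq, smul_comm]⟩

theorem Par.sub (h : Par ε φ) (h' : Par ε ψ) : Par ε (φ - ψ) :=
  ⟨h.sign, by rw [tw_sub, h.tw_eq, h'.tw_eq, smul_sub]⟩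

theorem Par.br (hφ : φ ∈ ML A) (hψ : ψ ∈ ML A) (h : Par ε φ) (h' : Par η ψ) :
    Par (ε * η) (br ε η φ ψ) :=
  (Par.ins hφ h h').sub (by rw [mul_comm]; exact (Par.ins hψ h' h).smul _)

theorem br_antisymm (hε : ε = 1 ∨ ε = -1) (hη : η = 1 ∨ η = -1) (φ ψ : Conv A A) :
    br ε η φ ψ = -(koszul ε η • br η ε ψ φ) := by
  rcases hε with rfl | rfl <;> rcases hη with rfl | rfl <;> simp [br, ← sub_eq_add_neg]

/-- The Jacobi identity, as a signed sum of the pre-Lie identities for `φ`, `ψ` and `χ`. -/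
theorem br_jacobi (hφ : φ ∈ ML A) (hψ : ψ ∈ ML A) (hχ : χ ∈ ML A) (pφ : Par ε φ) (pψ : Par η ψ)
    (pχ : Par ζ χ) :
    br ε (η * ζ) φ (br η ζ ψ χ) = br (ε * η) ζ (br ε η φ ψ) χ
      + koszul ε η • br η (ε * ζ) ψ (br ε ζ φ χ) := by
  have h1 := preLie hφ pψ pχ
  have h2 := preLie hψ pφ pχ
  have h3 := preLie hχ pψ pφ
  simp only [br, ins_sub_right _ hφ, ins_sub_right _ hψ, ins_sub_right _ hχ, ins_sub, ins_smul,
    ins_smul_right _ _ hφ, ins_smul_right _ _ hψ, ins_smul_right _ _ hχ]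
  rcases pφ.sign with rfl | rfl <;> rcases pψ.sign with rfl | rfl <;>
    rcases pχ.sign with rfl | rfl <;>
  simp only [koszul_one_left, koszul_one_right, koszul_neg_neg, one_smul, neg_smul, mul_one,
    mul_neg, neg_neg] at h1 h2 h3 ⊢ <;>
  first
  | linear_combination (norm := module) (-1 : ℝ) • h1 + h2 + h3
  | linear_combination (norm := module) (-1 : ℝ) • h1 + h2 - h3
  | linear_combination (norm := module) (-1 : ℝ) • h1 - h2 + h3
  | linear_combination (norm := module) (-1 : ℝ) • h1 - h2 - h3

/-- Bracketing with a cocycle commutes with the differential up to sign. -/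
theorem br_dif_left (hθ : θ ∈ ML A) (hψ : ψ ∈ ML A) (pθ : Par ε θ) (pψ : Par η ψ) (dψ : dif ψ = 0) :
    br (-ε) η (dif θ) ψ = η • dif (br ε η θ ψ) := by
  rw [br, br, dif_sub, dif_smul, dif_ins hθ pθ pψ, dif_ins hψ pψ pθ, dψ, ins_zero_right _ hθ,
    ins_zero_left]
  have h1 := pθ.tw_eq
  have h2 := pψ.tw_eq
  rcases pθ.sign with rfl | rfl <;> rcases pψ.sign with rfl | rfl <;>
  · simp [h1, h2]
    try abel

/-- The cup product of cocycles is graded commutative up to a coboundary. -/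
theorem mul_comm_homotopy (hφ : φ ∈ ML A) (pφ : Par ε φ) (pψ : Par η ψ) (dφ : dif φ = 0)
    (dψ : dif ψ = 0) : φ * ψ - koszul (-ε) (-η) • (ψ * φ) =
      (-(ε * η * koszul (-ε) η)) • dif (ins η φ ψ) := by
  rw [dif_ins hφ pφ pψ, dψ, dφ, ins_zero_right _ hφ, ins_zero_left]
  have h1 := pφ.tw_eq
  rcases pφ.sign with rfl | rfl <;> rcases pψ.sign with rfl | rfl <;>
  · simp [h1]
    try abel

/-- The Leibniz rule holds for cocycles up to a coboundary. -/
theorem leibniz_homotopy (hχ : χ ∈ ML A) (pφ : Par ε φ) (pψ : Par η ψ) (pχ : Par ζ χ)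
    (dφ : dif φ = 0) (dψ : dif ψ = 0) (dχ : dif χ = 0) :
    br (-(ε * η)) ζ (φ * ψ) χ - (br ε ζ φ χ * ψ + koszul (-ε) ζ • (φ * br η ζ ψ χ)) =
      (-(koszul (-(ε * η)) ζ * ε * η * koszul (-ε) η)) • dif (ins₂ ε η χ φ ψ) := by
  rw [dif_ins₂ hχ pχ pφ pψ dχ dφ dψ]
  simp only [br, ins_mul]
  have h1 := pφ.tw_eq
  have h2 := (Par.ins hχ pχ pφ).tw_eq
  have h3 := ins_neg_right ε hχ (φ * ψ)
  rcases pφ.sign with rfl | rfl <;> rcases pψ.sign with rfl | rfl <;>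
    rcases pχ.sign with rfl | rfl <;>
  · norm_num at h1 h2 h3
    simp [h1, h2, h3, sub_mul, mul_sub, add_mul, mul_add]
    try abel

end

end Conv

end Bracket

/-! ### The Gerstenhaber algebra of a subcomplex -/

section Subcomplex

set_option linter.unusedSectionVars false

open Conv

variable {A : Type*} [CommRing A] [Algebra ℝ A]

/-- The homogeneous component of degree `k` of a cochain. -/
def comp (k : ℤ) : Cochain A →ₗ[ℝ] Cochain A where
  toFun φ L := if (L.length : ℤ) = k then φ L else 0
  map_add' φ ψ := by funext L; by_cases h : (L.length : ℤ) = k <;> simp [h]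
  map_smul' c φ := by funext L; by_cases h : (L.length : ℤ) = k <;> simp [h]

theorem comp_apply (k : ℤ) (φ : Cochain A) (L : List A) :
    comp k φ L = if (L.length : ℤ) = k then φ L else 0 := rfl

theorem isHomog_comp (k : ℤ) (φ : Cochain A) : IsHomog k (comp k φ) :=
  fun L hL => by simp [comp_apply, hL]

theorem IsHomog.comp_eq {k : ℤ} {φ : Cochain A} (h : IsHomog k φ) (l : ℤ) :
    comp l φ = if k = l then φ else 0 := by
  funext L
  rw [comp_apply]
  split_ifs with h1 h2 h2
  · rfl
  · exact h L (by omega)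
  · exact (h L (by omega)).symm
  · rfl

theorem hochschild_comp (k : ℤ) (φ : Cochain A) :
    hochschild A (comp k φ) = comp (k + 1) (hochschild A φ) := by
  funext L
  match L with
  | [] => simp [comp_apply, hochschild, hochschildFun]
  | a :: T =>
    rw [comp_apply]
    change hochschildFun (comp k φ) (a :: T) =
      if ((a :: T).length : ℤ) = k + 1 then hochschildFun φ (a :: T) else 0
    have hL : (a :: T).length = T.length + 1 := rfl
    split_ifs with h
    · refine hochschildFun_congr (n := T.length) (fun L hL => ?_) hL
      rw [comp_apply, if_pos]
      simp at h; omega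
    · trans hochschildFun (0 : Cochain A) (a :: T)
      · refine hochschildFun_congr (n := T.length) (fun L hL => ?_) hL
        rw [comp_apply, if_neg]
        · rfl
        · simp at h; omega
      · exact congrFun (_root_.map_zero (hochschild A)) (a :: T)

/-- A space of cochains that is closed under the operations from which the Gerstenhaber algebra
structure on its cohomology is built. -/
structure BraceClosed (S : Submodule ℝ (Cochain A)) : Prop where
  le_HC : S ≤ HC A
  one_mem : (1 : Conv A A) ∈ S
  mul_mem : ∀ {φ ψ : Conv A A}, φ ∈ S → ψ ∈ S → φ * ψ ∈ S
  tw_mem : ∀ (ε : ℝ) {φ : Conv A A}, φ ∈ S → tw ε φ ∈ S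
  ins_mem : ∀ (ε : ℝ) {φ ψ : Conv A A}, φ ∈ S → ψ ∈ S → ins ε φ ψ ∈ S
  ins₂_mem : ∀ (ε η : ℝ) {φ ψ χ : Conv A A}, φ ∈ S → ψ ∈ S → χ ∈ S → ins₂ ε η φ ψ χ ∈ S
  comp_mem : ∀ (k : ℤ) {φ : Cochain A}, φ ∈ S → comp k φ ∈ S

theorem IsHomog.mul {k l : ℤ} {φ ψ : Conv A A} (hφ : IsHomog k φ) (hψ : IsHomog l ψ) :
    IsHomog (k + l) (φ * ψ) := by
  intro L hL
  rw [mul_def, csum]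
  refine Finset.sum_eq_zero fun i hi => ?_
  simp only [Finset.mem_range] at hi
  rw [Conv.smul_apply]
  by_cases h : ((L.take i).length : ℤ) = k
  · rw [hψ _ (by simp at h ⊢; omega), smul_zero]
  · rw [hφ _ h, zero_smul]

theorem IsHomog.ins {k l : ℤ} {φ ψ : Conv A A} (hx : φ ∈ ML A) (hφ : IsHomog k φ)
    (hψ : IsHomog l ψ) (ε : ℝ) : IsHomog (k + l - 1) (ins ε φ ψ) := by
  intro L hL
  rw [ins_eq_sum]
  refine Finset.sum_eq_zero fun i hi => Finset.sum_eq_zero fun m hm => ?_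
  simp only [Finset.mem_range] at hi hm
  by_cases h : (((L.drop i).take m).length : ℤ) = l
  · rw [hφ _ (by simp at h ⊢; omega), smul_zero]
  · rw [hψ _ h, ML_zero hx, smul_zero]

theorem IsHomog.br {k l : ℤ} {φ ψ : Conv A A} (hx : φ ∈ ML A) (hy : ψ ∈ ML A) (hφ : IsHomog k φ)
    (hψ : IsHomog l ψ) (ε η : ℝ) : IsHomog (k + l - 1) (br ε η φ ψ) := by
  intro L hL
  rw [Conv.br, Conv.sub_apply, Conv.smul_apply, hφ.ins hx hψ η L hL,
    hψ.ins hy hφ ε L (by rwa [add_comm l]), smul_zero, sub_zero]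

theorem br_add_left {ε η : ℝ} {ψ : Conv A A} (hψ : ψ ∈ ML A) (φ φ' : Conv A A) :
    br ε η (φ + φ') ψ = br ε η φ ψ + br ε η φ' ψ := by
  simp only [br, ins_add, ins_add_right _ hψ]; module

theorem br_smul_left {ε η : ℝ} {ψ : Conv A A} (hψ : ψ ∈ ML A) (s : ℝ) (φ : Conv A A) :
    br ε η (s • φ) ψ = s • br ε η φ ψ := by
  simp only [br, ins_smul, ins_smul_right _ _ hψ]; module

theorem br_add_right {ε η : ℝ} {φ : Conv A A} (hφ : φ ∈ ML A) (ψ ψ' : Conv A A) :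
    br ε η φ (ψ + ψ') = br ε η φ ψ + br ε η φ ψ' := by
  simp only [br, ins_add, ins_add_right _ hφ]; module

theorem br_smul_right {ε η : ℝ} {φ : Conv A A} (hφ : φ ∈ ML A) (s : ℝ) (ψ : Conv A A) :
    br ε η φ (s • ψ) = s • br ε η φ ψ := by
  simp only [br, ins_smul, ins_smul_right _ _ hφ]; module

/-- The part of a cochain of parity `ε`. -/
noncomputable def parity (ε : ℝ) (φ : Conv A A) : Conv A A := (1 / 2 : ℝ) • (φ - ε • tw (-1) φ)

theorem par_parity {ε : ℝ} (hε : ε = 1 ∨ ε = -1) (φ : Conv A A) : Par ε (parity ε φ) := by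
  refine ⟨hε, ?_⟩
  rw [parity, tw_smul, tw_sub, tw_smul, tw_tw]
  rcases hε with rfl | rfl <;>
  · norm_num
    try module

theorem parity_eq_self {ε : ℝ} {φ : Conv A A} (h : Par ε φ) : parity ε φ = φ := by
  rw [parity, h.tw_eq]
  rcases h.sign with rfl | rfl <;>
  · norm_num
    module

theorem parity_eq_zero {ε : ℝ} {φ : Conv A A} (h : Par ε φ) : parity (-ε) φ = 0 := by
  rw [parity, h.tw_eq]
  rcases h.sign with rfl | rfl <;> norm_num

theorem parity_add (ε : ℝ) (φ ψ : Conv A A) : parity ε (φ + ψ) = parity ε φ + parity ε ψ := by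
  simp only [parity, tw_add]; module

theorem parity_smul (ε s : ℝ) (φ : Conv A A) : parity ε (s • φ) = s • parity ε φ := by
  simp only [parity, tw_smul]; module

theorem dif_tw {φ : Conv A A} (h : φ ∈ ML A) : dif (tw (-1) φ) = -tw (-1) (dif φ) := by
  simp only [dif, tw_sub, tw_mul, tw_lett, tw_ins _ _ (by norm_num : (-1 : ℝ) * -1 = 1) h]
  simp
  abel

theorem dif_parity {φ : Conv A A} (h : φ ∈ ML A) (ε : ℝ) :
    dif (parity ε φ) = parity (-ε) (dif φ) := by
  rw [parity, parity, dif_smul, dif_sub, dif_smul, dif_tw h]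
  simp

/-- A bilinear map that vanishes on a submodule descends to the quotient. -/
theorem exists_bilinear_quotient {V W : Type*} [AddCommGroup V] [Module ℝ V] [AddCommGroup W]
    [Module ℝ W] (N : Submodule ℝ V) (f : V →ₗ[ℝ] V →ₗ[ℝ] W) (h₁ : ∀ x ∈ N, ∀ y, f x y = 0)
    (h₂ : ∀ x, ∀ y ∈ N, f x y = 0) :
    ∃ g : (V ⧸ N) →ₗ[ℝ] (V ⧸ N) →ₗ[ℝ] W, ∀ x y, g (N.mkQ x) (N.mkQ y) = f x y :=
  ⟨(N.liftQ (N.liftQ f fun x hx => LinearMap.ext (h₁ x hx)).flip fun y hy =>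
      LinearMap.ext fun x => by
        obtain ⟨x, rfl⟩ := N.mkQ_surjective x
        exact h₂ x y hy).flip, fun x y => rfl⟩

namespace BraceClosed

variable {S : Submodule ℝ (Cochain A)} (hS : BraceClosed S)

include hS

theorem ml {φ : Conv A A} (h : φ ∈ S) : φ ∈ ML A := (hS.le_HC h).1

theorem mem_cocycles {φ : Conv A A} : φ ∈ cocycles S ↔ φ ∈ S ∧ dif φ = 0 := by
  refine and_congr_right fun h => ?_
  change hochschild A φ = 0 ↔ _
  rw [hochschild_eq_dif (hS.ml h)]
  rfl

theorem dif_eq_zero {φ : Conv A A} (h : φ ∈ cocycles S) : dif φ = 0 := (hS.mem_cocycles.1 h).2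

theorem mk_eq_mk {φ ψ θ : Conv A A} {hφ : φ ∈ cocycles S} {hψ : ψ ∈ cocycles S} (hθ : θ ∈ S)
    (h : φ - ψ = dif θ) : HH.mk S ⟨φ, hφ⟩ = HH.mk S ⟨ψ, hψ⟩ := by
  rw [HH.mk, ← sub_eq_zero, ← _root_.map_sub, Submodule.mkQ_apply, Submodule.Quotient.mk_eq_zero]
  exact ⟨θ, hθ, (hochschild_eq_dif (hS.ml hθ)).trans h.symm⟩

theorem mk_eq_zero {φ θ : Conv A A} {hφ : φ ∈ cocycles S} (hθ : θ ∈ S) (h : φ = dif θ) :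
    HH.mk S ⟨φ, hφ⟩ = 0 := by
  rw [← _root_.map_zero (HH.mk S)]
  exact hS.mk_eq_mk (hψ := zero_mem _) hθ ((sub_zero φ).trans h)

theorem exists_dif {φ : Conv A A} {hφ : φ ∈ cocycles S}
    (h : (⟨φ, hφ⟩ : cocycles S) ∈ (coboundaries S).submoduleOf (cocycles S)) :
    ∃ θ : Conv A A, θ ∈ S ∧ φ = dif θ := by
  obtain ⟨θ, hθ, h⟩ := h
  exact ⟨θ, hθ, h.symm.trans (hochschild_eq_dif (hS.ml hθ))⟩

theorem parity_mem (ε : ℝ) {φ : Conv A A} (h : φ ∈ S) : parity ε φ ∈ S :=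
  S.smul_mem _ (S.sub_mem h (S.smul_mem _ (hS.tw_mem _ h)))

theorem br_mem (ε η : ℝ) {φ ψ : Conv A A} (h : φ ∈ S) (h' : ψ ∈ S) : br ε η φ ψ ∈ S :=
  S.sub_mem (hS.ins_mem _ h h') (S.smul_mem _ (hS.ins_mem _ h' h))

theorem mul_mem_cocycles {φ ψ : Conv A A} (h : φ ∈ cocycles S) (h' : ψ ∈ cocycles S) :
    φ * ψ ∈ cocycles S := by
  rw [hS.mem_cocycles] at h h' ⊢
  exact ⟨hS.mul_mem h.1 h'.1, by rw [dif_mul, h.2, h'.2, zero_mul, mul_zero, add_zero]⟩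

theorem one_mem_cocycles : (1 : Conv A A) ∈ cocycles S := by
  refine hS.mem_cocycles.2 ⟨hS.one_mem, ?_⟩
  have h : tw (-1) (1 : Conv A A) = 1 := by
    ext L; cases L <;> simp [tw_apply]
  rw [dif, h, ins_one]
  simp

theorem br_mem_cocycles {ε η : ℝ} {φ ψ : Conv A A} (h : φ ∈ cocycles S) (h' : ψ ∈ cocycles S)
    (p : Par ε φ) (p' : Par η ψ) : br ε η φ ψ ∈ cocycles S := by
  rw [hS.mem_cocycles] at h h' ⊢
  refine ⟨hS.br_mem _ _ h.1 h'.1, ?_⟩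
  have := br_dif_left (hS.ml h.1) (hS.ml h'.1) p p' h'.2
  rw [h.2, br, ins_zero_left, ins_zero_right _ (hS.ml h'.1)] at this
  rcases p'.sign with rfl | rfl <;> simpa using this.symm

theorem parity_mem_cocycles (ε : ℝ) {φ : Conv A A} (h : φ ∈ cocycles S) :
    parity ε φ ∈ cocycles S := by
  rw [hS.mem_cocycles] at h ⊢
  refine ⟨hS.parity_mem _ h.1, ?_⟩
  rw [dif_parity (hS.ml h.1), h.2]
  simpa using parity_smul (-ε) 0 (0 : Conv A A)

/-- The cup product of classes. -/
theorem exists_mul : ∃ m : HH S →ₗ[ℝ] HH S →ₗ[ℝ] HH S, ∀ z w : cocycles S,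
    m (HH.mk S z) (HH.mk S w) = HH.mk S ⟨cup (z : Cochain A) w, hS.mul_mem_cocycles z.2 w.2⟩ := by
  refine exists_bilinear_quotient _ (LinearMap.mk₂ ℝ
    (fun z w : cocycles S => HH.mk S ⟨cup (z : Cochain A) w, hS.mul_mem_cocycles z.2 w.2⟩)
    ?_ ?_ ?_ ?_) ?_ ?_
  · intro z z' w
    rw [← _root_.map_add]; congr 1; exact Subtype.ext (add_mul (R := Conv A A) z.1 z'.1 w.1)
  · intro s z w
    rw [← _root_.map_smul]; congr 1; exact Subtype.ext (real_smul_mul s z.1 w.1)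
  · intro z w w'
    rw [← _root_.map_add]; congr 1; exact Subtype.ext (mul_add (R := Conv A A) z.1 w.1 w'.1)
  · intro s z w
    rw [← _root_.map_smul]; congr 1; exact Subtype.ext (mul_real_smul s z.1 w.1)
  · rintro ⟨(z : Conv A A), hz⟩ hz' ⟨(w : Conv A A), hw⟩
    obtain ⟨θ, hθ, rfl⟩ := hS.exists_dif hz'
    refine hS.mk_eq_zero (φ := dif θ * w) (hS.mul_mem hθ hw.1) ?_
    rw [dif_mul, hS.dif_eq_zero hw, mul_zero, add_zero]
  · rintro ⟨(z : Conv A A), hz⟩ ⟨(w : Conv A A), hw⟩ hw'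
    obtain ⟨θ, hθ, rfl⟩ := hS.exists_dif hw'
    refine hS.mk_eq_zero (φ := z * dif θ) (hS.mul_mem (hS.tw_mem (-1) hz.1) hθ) ?_
    have h0 : tw (-1) (0 : Conv A A) = 0 := by ext L; simp [tw_apply]
    rw [dif_mul, dif_tw (hS.ml hz.1), hS.dif_eq_zero hz, tw_tw, h0, neg_zero, zero_mul, zero_add]
    norm_num

theorem br_dif_left_mk {ε η : ℝ} {θ ψ : Conv A A} (hθ : θ ∈ S) (hψ : ψ ∈ cocycles S)
    (p : Par ε θ) (p' : Par η ψ) {h : br (-ε) η (dif θ) ψ ∈ cocycles S} :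
    HH.mk S ⟨br (-ε) η (dif θ) ψ, h⟩ = 0 := by
  refine hS.mk_eq_zero (S.smul_mem η (hS.br_mem ε η hθ hψ.1)) ?_
  rw [br_dif_left (hS.ml hθ) (hS.ml hψ.1) p p' (hS.dif_eq_zero hψ)]
  exact (dif_smul _ _).symm

/-- The bracket of the parity components of two cocycles, as a bilinear map. -/
theorem exists_br_aux {ε η : ℝ} (hε : ε = 1 ∨ ε = -1) (hη : η = 1 ∨ η = -1) :
    ∃ b : HH S →ₗ[ℝ] HH S →ₗ[ℝ] HH S, ∀ z w : cocycles S,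
      b (HH.mk S z) (HH.mk S w) = HH.mk S ⟨br ε η (parity ε (z : Cochain A))
        (parity η (w : Cochain A)), hS.br_mem_cocycles (hS.parity_mem_cocycles ε z.2)
          (hS.parity_mem_cocycles η w.2) (par_parity hε _) (par_parity hη _)⟩ := by
  refine exists_bilinear_quotient _ (LinearMap.mk₂ ℝ
    (fun z w : cocycles S => HH.mk S ⟨br ε η (parity ε (z : Cochain A))
        (parity η (w : Cochain A)), hS.br_mem_cocycles (hS.parity_mem_cocycles ε z.2)
          (hS.parity_mem_cocycles η w.2) (par_parity hε _) (par_parity hη _)⟩)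
    ?_ ?_ ?_ ?_) ?_ ?_
  · intro z z' w
    rw [← _root_.map_add]; congr 1; refine Subtype.ext ?_
    exact (congrArg (br ε η · _) (parity_add ε z.1 z'.1)).trans
      (br_add_left (hS.ml (hS.parity_mem η w.2.1)) _ _)
  · intro s z w
    rw [← _root_.map_smul]; congr 1; refine Subtype.ext ?_
    exact (congrArg (br ε η · _) (parity_smul ε s z.1)).trans
      (br_smul_left (hS.ml (hS.parity_mem η w.2.1)) _ _)
  · intro z w w'
    rw [← _root_.map_add]; congr 1; refine Subtype.ext ?_
    exact (congrArg (br ε η _ ·) (parity_add η w.1 w'.1)).trans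
      (br_add_right (hS.ml (hS.parity_mem ε z.2.1)) _ _)
  · intro s z w
    rw [← _root_.map_smul]; congr 1; refine Subtype.ext ?_
    exact (congrArg (br ε η _ ·) (parity_smul η s w.1)).trans
      (br_smul_right (hS.ml (hS.parity_mem ε z.2.1)) _ _)
  · rintro ⟨(z : Conv A A), hz⟩ hz' ⟨(w : Conv A A), hw⟩
    obtain ⟨θ, hθ, rfl⟩ := hS.exists_dif hz'
    have := hS.br_dif_left_mk (hS.parity_mem (-ε) hθ) (hS.parity_mem_cocycles η hw)
      (par_parity (by rcases hε with rfl | rfl <;> simp) θ) (par_parity hη w)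
      (h := by
        rw [dif_parity (hS.ml hθ), neg_neg]
        exact hS.br_mem_cocycles (hS.parity_mem_cocycles ε hz) (hS.parity_mem_cocycles η hw)
          (par_parity hε _) (par_parity hη _))
    simp only [dif_parity (hS.ml hθ), neg_neg] at this
    exact this
  · rintro ⟨(z : Conv A A), hz⟩ ⟨(w : Conv A A), hw⟩ hw'
    obtain ⟨θ, hθ, rfl⟩ := hS.exists_dif hw'
    have := hS.br_dif_left_mk (hS.parity_mem (-η) hθ) (hS.parity_mem_cocycles ε hz)
      (par_parity (by rcases hη with rfl | rfl <;> simp) θ) (par_parity hε z)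
      (h := by
        rw [dif_parity (hS.ml hθ), neg_neg]
        exact hS.br_mem_cocycles (hS.parity_mem_cocycles η hw) (hS.parity_mem_cocycles ε hz)
          (par_parity hη _) (par_parity hε _))
    simp only [dif_parity (hS.ml hθ), neg_neg] at this
    rw [← smul_zero (-koszul ε η), ← this, ← _root_.map_smul]
    refine congrArg (HH.mk S) (Subtype.ext ?_)
    exact (br_antisymm hε hη _ _).trans (neg_smul _ _).symm

/-- The Gerstenhaber bracket of classes. -/
theorem exists_br : ∃ b : HH S →ₗ[ℝ] HH S →ₗ[ℝ] HH S, ∀ (ε η : ℝ) (φ ψ : Conv A A)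
    (hφ : φ ∈ cocycles S) (hψ : ψ ∈ cocycles S) (p : Par ε φ) (p' : Par η ψ),
    b (HH.mk S ⟨φ, hφ⟩) (HH.mk S ⟨ψ, hψ⟩) =
      HH.mk S ⟨br ε η φ ψ, hS.br_mem_cocycles hφ hψ p p'⟩ := by
  obtain ⟨b₁, h₁⟩ := hS.exists_br_aux (ε := 1) (η := 1) (.inl rfl) (.inl rfl)
  obtain ⟨b₂, h₂⟩ := hS.exists_br_aux (ε := 1) (η := -1) (.inl rfl) (.inr rfl)
  obtain ⟨b₃, h₃⟩ := hS.exists_br_aux (ε := -1) (η := 1) (.inr rfl) (.inl rfl)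
  obtain ⟨b₄, h₄⟩ := hS.exists_br_aux (ε := -1) (η := -1) (.inr rfl) (.inr rfl)
  -- The sign in the bracket depends on the parities, and for cocycles with parities all but one of
  -- the four summands vanish.
  refine ⟨b₁ + b₂ + b₃ + b₄, fun ε η φ ψ hφ hψ p p' => ?_⟩
  simp only [LinearMap.add_apply, h₁, h₂, h₃, h₄, ← _root_.map_add]
  refine congrArg _ (Subtype.ext ?_)
  change br 1 1 (parity 1 φ) (parity 1 ψ) + br 1 (-1) (parity 1 φ) (parity (-1) ψ)
    + br (-1) 1 (parity (-1) φ) (parity 1 ψ) + br (-1) (-1) (parity (-1) φ) (parity (-1) ψ) =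
    br ε η φ ψ
  have e1 := parity_eq_self p
  have e2 := parity_eq_zero p
  have e3 := parity_eq_self p'
  have e4 := parity_eq_zero p'
  have e5 (ε η : ℝ) : br ε η 0 ψ = 0 := by
    simp [br, ins_zero_left, ins_zero_right _ (hS.ml hψ.1)]
  have e6 (ε η : ℝ) : br ε η φ 0 = 0 := by
    simp [br, ins_zero_left, ins_zero_right _ (hS.ml hφ.1)]
  have e7 (ε η : ℝ) : br ε η (0 : Conv A A) 0 = 0 := by
    simp [br, ins_zero_left]
  rcases p.sign with rfl | rfl <;> rcases p'.sign with rfl | rfl <;>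
  · norm_num at e2 e4
    simp [e1, e2, e3, e4, e5, e6, e7]

end BraceClosed

end Subcomplex

section Existence

set_option linter.unusedSectionVars false

open Conv

variable {A : Type*} [CommRing A] [Algebra ℝ A]

theorem mem_deg {S : Submodule ℝ (Cochain A)} {k : ℤ} {a : HH S} :
    a ∈ HH.deg S k ↔ ∃ (φ : Conv A A) (h : φ ∈ cocycles S), IsHomog k φ ∧ HH.mk S ⟨φ, h⟩ = a := by
  constructor
  · rintro ⟨⟨φ, h⟩, hφ, rfl⟩
    exact ⟨φ, h, hφ, rfl⟩
  · rintro ⟨φ, h, hφ, rfl⟩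
    exact ⟨⟨φ, h⟩, hφ, rfl⟩

theorem exists_rep {S : Submodule ℝ (Cochain A)} (a : HH S) :
    ∃ (φ : Conv A A) (h : φ ∈ cocycles S), HH.mk S ⟨φ, h⟩ = a := by
  obtain ⟨⟨φ, h⟩, rfl⟩ := Submodule.mkQ_surjective _ a
  exact ⟨φ, h, rfl⟩

namespace BraceClosed

variable {S : Submodule ℝ (Cochain A)} (hS : BraceClosed S)

include hS

theorem comp_mem_cocycles (k : ℤ) {φ : Cochain A} (h : φ ∈ cocycles S) :
    comp k φ ∈ cocycles S := by
  refine ⟨hS.comp_mem k h.1, ?_⟩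
  change hochschild A _ = 0
  rw [hochschild_comp, show hochschild A φ = 0 from h.2, _root_.map_zero]

/-- The projection of the cohomology to its part of degree `k`. -/
theorem exists_proj (k : ℤ) : ∃ p : HH S →ₗ[ℝ] HH S, ∀ z : cocycles S,
    p (HH.mk S z) = HH.mk S ⟨comp k (z : Cochain A), hS.comp_mem_cocycles k z.2⟩ := by
  refine ⟨Submodule.mapQ _ _ ((comp k).restrict fun z hz => hS.comp_mem_cocycles k hz) ?_,
    fun z => rfl⟩
  rintro ⟨z, hz⟩ ⟨θ, hθ, h⟩
  refine ⟨comp (k - 1) θ, hS.comp_mem _ hθ, ?_⟩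
  rw [hochschild_comp, h, sub_add_cancel]
  rfl

theorem isInternal : DirectSum.IsInternal (HH.deg S) := by
  constructor
  · intro d d' hd
    refine DFinsupp.ext fun k => Subtype.ext ?_
    obtain ⟨p, hp⟩ := hS.exists_proj k
    have key : ∀ d : DirectSum ℤ fun k => HH.deg S k,
        p (DirectSum.coeAddMonoidHom (HH.deg S) d) = d k := by
      intro d
      induction d using DirectSum.induction_on with
      | zero => simp
      | of l x =>
        obtain ⟨_, ⟨φ, hφ⟩, h, rfl⟩ := x
        rw [DirectSum.coeAddMonoidHom_of, hp]
        by_cases hl : l = k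
        · subst hl
          rw [DirectSum.of_eq_same]
          exact congrArg (HH.mk S) (Subtype.ext ((IsHomog.comp_eq h l).trans (if_pos rfl)))
        · rw [DirectSum.of_eq_of_ne _ _ _ (Ne.symm hl)]
          refine (congrArg (HH.mk S) (Subtype.ext ?_)).trans (_root_.map_zero _)
          exact (IsHomog.comp_eq h k).trans (if_neg hl)
      | add x y hx hy => simp [hx, hy]
    exact (key d).symm.trans ((congrArg p hd).trans (key d'))
  · intro a
    obtain ⟨φ, hφ, rfl⟩ := exists_rep a
    obtain ⟨N, hN⟩ := (hS.le_HC hφ.1).2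
    refine ⟨∑ k ∈ Finset.range (N + 1), DirectSum.of (fun k : ℤ => HH.deg S k) (k : ℤ)
      ⟨HH.mk S ⟨comp k φ, hS.comp_mem_cocycles k hφ⟩, mem_deg.2
        ⟨comp k φ, hS.comp_mem_cocycles k hφ, isHomog_comp _ _, rfl⟩⟩, ?_⟩
    rw [_root_.map_sum]
    simp only [DirectSum.coeAddMonoidHom_of]
    rw [← _root_.map_sum]
    refine congrArg (HH.mk S) (Subtype.ext ?_)
    rw [AddSubmonoidClass.coe_finsetSum]
    funext L
    rw [Finset.sum_apply]
    change ∑ k ∈ Finset.range (N + 1), (if (L.length : ℤ) = (k : ℤ) then φ L else 0) = φ L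
    simp only [Nat.cast_inj]
    rw [Finset.sum_ite_eq]
    split_ifs with h
    · rfl
    · exact (hN L (by simpa using h)).symm

/-- The cohomology of a space of cochains that is closed under cup product, insertions and braces
is a Gerstenhaber algebra. -/
theorem exists_gerstenhaber :
    ∃ G : GerstenhaberAlgebra ℝ (HH S) (HH.deg S), IsInduced G := by
  obtain ⟨m, hm⟩ := hS.exists_mul
  obtain ⟨b, hb⟩ := hS.exists_br
  have hm' {φ ψ : Conv A A} (hφ : φ ∈ cocycles S) (hψ : ψ ∈ cocycles S) :
      m (HH.mk S ⟨φ, hφ⟩) (HH.mk S ⟨ψ, hψ⟩) = HH.mk S ⟨φ * ψ, hS.mul_mem_cocycles hφ hψ⟩ :=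
    hm ⟨φ, hφ⟩ ⟨ψ, hψ⟩
  refine ⟨
    { mul := m
      one := HH.mk S ⟨(1 : Conv A A), hS.one_mem_cocycles⟩
      bracket := b
      isInternal := hS.isInternal
      one_mem := mem_deg.2 ⟨1, hS.one_mem_cocycles, fun L hL => ?_, rfl⟩
      mul_mem := ?_
      bracket_mem := ?_
      one_mul := ?_
      mul_one := ?_
      mul_assoc := ?_
      graded_comm := ?_
      bracket_antisymm := ?_
      jacobi := ?_
      leibniz := ?_ }, ?_⟩
  · cases L with
    | nil => simp at hL
    | cons a L => simp
  · intro k l x y hx hy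
    obtain ⟨φ, hφ, h, rfl⟩ := mem_deg.1 hx
    obtain ⟨ψ, hψ, h', rfl⟩ := mem_deg.1 hy
    rw [hm' hφ hψ]
    exact mem_deg.2 ⟨_, _, h.mul h', rfl⟩
  · intro k l x y hx hy
    obtain ⟨φ, hφ, h, rfl⟩ := mem_deg.1 hx
    obtain ⟨ψ, hψ, h', rfl⟩ := mem_deg.1 hy
    rw [hb _ _ _ _ hφ hψ h.par h'.par]
    exact mem_deg.2 ⟨_, _, h.br (hS.ml hφ.1) (hS.ml hψ.1) h' _ _, rfl⟩
  · intro x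
    obtain ⟨φ, hφ, rfl⟩ := exists_rep x
    rw [hm']
    simp only [_root_.one_mul]
  · intro x
    obtain ⟨φ, hφ, rfl⟩ := exists_rep x
    rw [hm']
    simp only [_root_.mul_one]
  · intro x y z
    obtain ⟨φ, hφ, rfl⟩ := exists_rep x
    obtain ⟨ψ, hψ, rfl⟩ := exists_rep y
    obtain ⟨χ, hχ, rfl⟩ := exists_rep z
    simp only [hm', _root_.mul_assoc]
  · intro k l x y hx hy
    obtain ⟨φ, hφ, h, rfl⟩ := mem_deg.1 hx
    obtain ⟨ψ, hψ, h', rfl⟩ := mem_deg.1 hy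
    rw [hm', hm', negOnePow_smul, sg_mul, ← _root_.map_smul]
    have := mul_comm_homotopy (hS.ml hφ.1) h.par h'.par (hS.dif_eq_zero hφ) (hS.dif_eq_zero hψ)
    rw [sg_sub_one, sg_sub_one, neg_neg, neg_neg, ← dif_smul] at this
    exact hS.mk_eq_mk (S.smul_mem _ (hS.ins_mem _ hφ.1 hψ.1)) this
  · intro k l x y hx hy
    obtain ⟨φ, hφ, h, rfl⟩ := mem_deg.1 hx
    obtain ⟨ψ, hψ, h', rfl⟩ := mem_deg.1 hy
    rw [hb _ _ _ _ hφ hψ h.par h'.par, hb _ _ _ _ hψ hφ h'.par h.par, negOnePow_smul, sg_mul,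
      ← _root_.map_smul, ← _root_.map_neg]
    exact congrArg (HH.mk S) (Subtype.ext (br_antisymm h.par.sign h'.par.sign φ ψ))
  · intro k l n x y z hx hy hz
    obtain ⟨φ, hφ, h, rfl⟩ := mem_deg.1 hx
    obtain ⟨ψ, hψ, h', rfl⟩ := mem_deg.1 hy
    obtain ⟨χ, hχ, h'', rfl⟩ := mem_deg.1 hz
    have p := h.par
    have p' := h'.par
    have p'' := h''.par
    have q := Par.br (hS.ml hψ.1) (hS.ml hχ.1) p' p''
    have q' := Par.br (hS.ml hφ.1) (hS.ml hψ.1) p p'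
    have q'' := Par.br (hS.ml hφ.1) (hS.ml hχ.1) p p''
    rw [hb _ _ _ _ hψ hχ p' p'', hb _ _ _ _ hφ hψ p p', hb _ _ _ _ hφ hχ p p'',
      hb _ _ _ _ hφ _ p q, hb _ _ _ _ _ hχ q' p'', hb _ _ _ _ hψ _ p' q'', negOnePow_smul, sg_mul,
      ← _root_.map_smul, ← _root_.map_add]
    exact congrArg (HH.mk S) (Subtype.ext
      (br_jacobi (hS.ml hφ.1) (hS.ml hψ.1) (hS.ml hχ.1) p p' p''))
  · intro k l n x y z hx hy hz
    obtain ⟨φ, hφ, h, rfl⟩ := mem_deg.1 hx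
    obtain ⟨ψ, hψ, h', rfl⟩ := mem_deg.1 hy
    obtain ⟨χ, hχ, h'', rfl⟩ := mem_deg.1 hz
    have p := h.par
    have p' := h'.par
    have p'' := h''.par
    rw [hm' hφ hψ, hb _ _ _ _ _ hχ (p.mul p') p'', hb _ _ _ _ hφ hχ p p'',
      hb _ _ _ _ hψ hχ p' p'', hm', hm', negOnePow_smul, sg_mul, ← _root_.map_smul,
      ← _root_.map_add]
    have := leibniz_homotopy (hS.ml hχ.1) p p' p'' (hS.dif_eq_zero hφ) (hS.dif_eq_zero hψ)
      (hS.dif_eq_zero hχ)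
    rw [← dif_smul, show -sg (k - 1) = sg k by rw [sg_sub_one, neg_neg]] at this
    exact hS.mk_eq_mk (S.smul_mem _ (hS.ins₂_mem _ _ hχ.1 hφ.1 hψ.1)) this
  · refine ⟨?_, fun z w => ⟨hS.mul_mem_cocycles z.2 w.2, hm z w⟩, ?_⟩
    · have h : unitCochain ∈ cocycles S := by
        rw [unitCochain_eq_one]; exact hS.one_mem_cocycles
      exact ⟨h, congrArg (HH.mk S) (Subtype.ext unitCochain_eq_one.symm)⟩
    · rintro k l ⟨φ, hφ⟩ ⟨ψ, hψ⟩ h h'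
      have p := IsHomog.par (φ := φ) h
      have p' := IsHomog.par (φ := ψ) h'
      rw [sg_natCast_sub_one] at p p'
      have e : gBracket k l φ ψ = br _ _ φ ψ := gBracket_eq_br (hS.ml hφ.1) (hS.ml hψ.1) h h'
      refine ⟨e ▸ hS.br_mem_cocycles hφ hψ p p', (hb _ _ φ ψ hφ hψ p p').trans ?_⟩
      exact congrArg (HH.mk S) (Subtype.ext e.symm)

end BraceClosed

/-- A linear map of cohomologies that is induced by a map of cocycles compatible with the
operations is a morphism of Gerstenhaber algebras. -/
theorem isGerstenhaberHom_of_cocycles {B : Type*} [CommRing B] [Algebra ℝ B]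
    {S : Submodule ℝ (Cochain A)} {S' : Submodule ℝ (Cochain B)}
    {G : GerstenhaberAlgebra ℝ (HH S) (HH.deg S)} {G' : GerstenhaberAlgebra ℝ (HH S') (HH.deg S')}
    (hG : IsInduced G) (hG' : IsInduced G') (f : HH S →ₗ[ℝ] HH S') (r : Cochain A → Cochain B)
    (hr : ∀ z ∈ cocycles S, r z ∈ cocycles S')
    (hf : ∀ z, f (HH.mk S z) = HH.mk S' ⟨r z, hr z z.2⟩)
    (homog : ∀ (k : ℤ), ∀ z ∈ cocycles S, IsHomog k z → IsHomog k (r z))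
    (one : r unitCochain = unitCochain)
    (mul : ∀ z ∈ cocycles S, ∀ w ∈ cocycles S, r (cup z w) = cup (r z) (r w))
    (bracket : ∀ (k l : ℕ), ∀ z ∈ cocycles S, ∀ w ∈ cocycles S, IsHomog k z → IsHomog l w →
      r (gBracket k l z w) = gBracket k l (r z) (r w)) :
    IsGerstenhaberHom G G' f where
  map_mem := by
    rintro k _ ⟨z, hz, rfl⟩
    exact ⟨⟨r z, hr z z.2⟩, homog k z z.2 hz, (hf z).symm⟩
  map_one := by
    obtain ⟨h, e⟩ := hG.one
    obtain ⟨h', e'⟩ := hG'.one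
    rw [e, e', hf]
    exact congrArg (HH.mk S') (Subtype.ext one)
  map_mul a b := by
    obtain ⟨z, rfl⟩ := Submodule.mkQ_surjective _ a
    obtain ⟨w, rfl⟩ := Submodule.mkQ_surjective _ b
    obtain ⟨h, e⟩ := hG.mul z w
    obtain ⟨h', e'⟩ := hG'.mul ⟨r z, hr z z.2⟩ ⟨r w, hr w w.2⟩
    change f (G.mul (HH.mk S z) (HH.mk S w)) = G'.mul (f (HH.mk S z)) (f (HH.mk S w))
    rw [e, hf, hf, hf, e']
    exact congrArg (HH.mk S') (Subtype.ext (mul z z.2 w w.2))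
  map_bracket a b := by
    -- `IsInduced` describes the bracket in natural degrees; in negative degrees all classes vanish.
    have neg {k : ℤ} (hk : k < 0) {a : HH S} (ha : a ∈ HH.deg S k) : a = 0 := by
      obtain ⟨φ, hφ, h, rfl⟩ := mem_deg.1 ha
      refine (congrArg (HH.mk S) (Subtype.ext ?_)).trans (_root_.map_zero _)
      exact funext fun L => h L (by omega)
    have key {k l : ℤ} {a b : HH S} (ha : a ∈ HH.deg S k) (hb : b ∈ HH.deg S l) :
        f (G.bracket a b) = G'.bracket (f a) (f b) := by
      rcases lt_or_ge k 0 with hk | hk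
      · simp [neg hk ha]
      rcases lt_or_ge l 0 with hl | hl
      · simp [neg hl hb]
      lift k to ℕ using hk
      lift l to ℕ using hl
      obtain ⟨z, hz, rfl⟩ := ha
      obtain ⟨w, hw, rfl⟩ := hb
      obtain ⟨h, e⟩ := hG.bracket k l z w hz hw
      obtain ⟨h', e'⟩ := hG'.bracket k l ⟨r z, hr z z.2⟩ ⟨r w, hr w w.2⟩ (homog k z z.2 hz)
        (homog l w w.2 hw)
      rw [e, hf, hf, hf, e']
      exact congrArg (HH.mk S') (Subtype.ext (bracket k l z z.2 w w.2 hz hw))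
    have top (a : HH S) : a ∈ ⨆ k, HH.deg S k := by
      rw [G.isInternal.submodule_iSup_eq_top]; trivial
    refine Submodule.iSup_induction _
      (motive := fun a => f (G.bracket a b) = G'.bracket (f a) (f b)) (top a) ?_ ?_ ?_
    · intro k a ha
      refine Submodule.iSup_induction _
        (motive := fun b => f (G.bracket a b) = G'.bracket (f a) (f b)) (top b) ?_ ?_ ?_
      · exact fun l b hb => key ha hb
      · simp
      · intro x y hx hy; simp [hx, hy]
    · simp
    · intro x y hx hy; simp [hx, hy]

end Existence

/-! ### Multidifferential cochains are closed under the operations -/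

section DiffCochains

set_option linter.unusedSectionVars false

open Conv

variable {A : Type*} [CommRing A] [Algebra ℝ A]

theorem DiffOrderLT.mul_left {n : ℕ} {D : A → A} (c : A) (h : DiffOrderLT n D) :
    DiffOrderLT n (fun b => c * D b) := by
  induction n generalizing D with
  | zero => intro a; simp [h a]
  | succ n ih =>
    intro a
    convert ih (h a) using 2
    ring

theorem DiffOrderLT.comp {r s : ℕ} {D D' : A → A} (hD : ∀ a b, D (a + b) = D a + D b)
    (h : DiffOrderLT r D) (h' : DiffOrderLT s D') : DiffOrderLT (r + s) (fun b => D (D' b)) := by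
  have sub {D : A → A} (hD : ∀ a b, D (a + b) = D a + D b) (a b : A) : D (a - b) = D a - D b := by
    rw [eq_sub_iff_add_eq, ← hD, sub_add_cancel]
  induction hn : r + s generalizing r s D D' with
  | zero =>
    obtain rfl : r = 0 := by omega
    exact fun a => h _
  | succ n ih =>
    intro a
    have e : (fun b => D (D' (a * b)) - a * D (D' b)) =
        fun b => D (D' (a * b) - a * D' b) + (D (a * D' b) - a * D (D' b)) := by
      funext b; rw [sub hD]; ring
    rw [e]
    refine DiffOrderLT.add ?_ ?_
    · cases s with
      | zero =>
        have h0 : D 0 = 0 := by simpa using hD 0 0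
        convert DiffOrderLT.zero (A := A) n using 2
        rw [h', h', mul_zero, sub_zero, h0]
      | succ s => exact ih hD h (h' a) (by omega)
    · cases r with
      | zero => convert DiffOrderLT.zero (A := A) n using 2; rw [h, h, mul_zero, sub_zero]
      | succ r => exact ih (fun b c => by rw [mul_add, hD, hD]; ring) (h a) h' (by omega)

/-- `D` is an `ℝ`-linear differential operator of order `< r` on `A` that commutes with the
multiplications by the elements of `P`. -/
structure IsOp (P : Set A) (r : ℕ) (D : A → A) : Prop where
  linear : ∀ (a b : A) (s t : ℝ), D (s • a + t • b) = s • D a + t • D b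
  order : DiffOrderLT r D
  comm : ∀ u ∈ P, ∀ a, D (u * a) = u * D a

namespace IsOp

variable {P : Set A} {r s : ℕ} {D D' : A → A}

theorem zero (r : ℕ) : IsOp P r (fun _ => 0) := ⟨by simp, .zero r, by simp⟩

theorem add (h : IsOp P r D) (h' : IsOp P r D') : IsOp P r (fun a => D a + D' a) :=
  ⟨fun a b s t => by simp only [h.linear, h'.linear]; module, h.order.add h'.order,
    fun u hu a => by rw [h.comm u hu, h'.comm u hu, mul_add]⟩

theorem mul_left (c : A) (h : IsOp P r D) : IsOp P r (fun a => c * D a) :=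
  ⟨fun a b s t => by simp only [h.linear, mul_add, mul_smul_comm], h.order.mul_left c,
    fun u hu a => by rw [h.comm u hu]; ring⟩

theorem smul (c : ℝ) (h : IsOp P r D) : IsOp P r (fun a => c • D a) := by
  simpa only [Algebra.smul_def] using h.mul_left (algebraMap ℝ A c)

theorem mul_right (c : A) (h : IsOp P r D) : IsOp P r (fun a => D a * c) := by
  simpa only [mul_comm c] using h.mul_left c

theorem mono (hrs : r ≤ s) (h : IsOp P r D) : IsOp P s D := ⟨h.linear, h.order.mono hrs, h.comm⟩

theorem comp (h : IsOp P r D) (h' : IsOp P s D') : IsOp P (r + s) (fun a => D (D' a)) :=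
  ⟨fun a b s t => by rw [h'.linear, h.linear],
    h.order.comp (fun a b => by simpa using h.linear a b 1 1) h'.order,
    fun u hu a => by rw [h'.comm u hu, h.comm u hu]⟩

theorem sum {ι : Type*} (t : Finset ι) {D : ι → A → A} (h : ∀ i ∈ t, IsOp P r (D i)) :
    IsOp P r (fun a => ∑ i ∈ t, D i a) := by
  classical
  induction t using Finset.induction_on with
  | empty => simpa using zero r
  | insert i t hi ih =>
    simp only [Finset.sum_insert hi]
    exact (h i (by simp)).add (ih fun j hj => h j (by simp [hj]))

end IsOp

/-- The cochain `φ` is in every argument an operator in the sense of `IsOp`, of order `< r`. -/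
def IsMultiOp (P : Set A) (r : ℕ) (φ : Conv A A) : Prop :=
  ∀ K L : List A, IsOp P r (fun a => φ (K ++ a :: L))

namespace Conv

/-- The derivative of a function on words by a word. -/
def DD (K : List A) (f : Conv A A) : Conv A A := fun L => f (K ++ L)

theorem DD_apply (K : List A) (f : Conv A A) (L : List A) : DD K f L = f (K ++ L) := rfl

theorem D_DD (x : A) (K : List A) (f : Conv A A) : D x (DD K f) = DD (K ++ [x]) f := by
  ext L; simp [DD_apply]

theorem ins_eq_csum (ε : ℝ) (f z : Conv A A) :
    ins ε f z = csum fun K => ε ^ K.length • hd (DD K f) z := by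
  ext L
  induction L generalizing f with
  | nil => simp [show DD [] f = f from rfl]
  | cons a L ih =>
    rw [ins_cons, ih, csum_cons, ← Conv.smul_apply, ← csum_smul]
    simp only [List.length_cons, pow_succ', mul_smul]
    simp [show DD [] f = f from rfl, show ∀ K, DD (a :: K) f = DD K (D a f) from fun _ => rfl]

theorem ins₂_eq_csum (ε η : ℝ) (f z w : Conv A A) :
    ins₂ ε η f z w = csum fun K => (ε * η) ^ K.length • hd₂ η (DD K f) z w := by
  ext L
  induction L generalizing f with
  | nil => simp [show DD [] f = f from rfl]
  | cons a L ih =>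
    rw [ins₂_cons, ih, csum_cons, ← Conv.smul_apply, ← csum_smul]
    simp only [List.length_cons, pow_succ' (ε * η), mul_smul]
    simp [show DD [] f = f from rfl, show ∀ K, DD (a :: K) f = DD K (D a f) from fun _ => rfl]

end Conv

namespace IsMultiOp

variable {P : Set A} {r s t : ℕ} {φ ψ χ : Conv A A}

theorem mono (hrs : r ≤ s) (h : IsMultiOp P r φ) : IsMultiOp P s φ :=
  fun K L => (h K L).mono hrs

theorem mem_ML (h : IsMultiOp P r φ) : φ ∈ ML A := fun K L => (h K L).linear

theorem smul (c : ℝ) (h : IsMultiOp P r φ) : IsMultiOp P r (c • φ) :=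
  fun K L => (h K L).smul c

theorem tw (ε : ℝ) (h : IsMultiOp P r φ) : IsMultiOp P r (tw ε φ) := fun K L => by
  simpa [tw_apply] using (h K L).smul (ε ^ (K ++ 0 :: L).length)

theorem DD (K : List A) (h : IsMultiOp P r φ) : IsMultiOp P r (DD K φ) := fun K' L => by
  simpa [DD_apply] using h (K ++ K') L

theorem one : IsMultiOp P r (1 : Conv A A) := fun K L => by
  simpa [one_def] using IsOp.zero r

/-- A sum over the cuts of a word is a multidifferential operator if the summands are ones in both
parts of the word. -/
theorem csum {Φ : List A → Conv A A} (h₁ : ∀ L, IsMultiOp P r (fun K => Φ K L))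
    (h₂ : ∀ K, IsMultiOp P r (Φ K)) : IsMultiOp P r (csum Φ) := fun K L => by
  simp only [Conv.csum, List.length_append, List.length_cons]
  refine IsOp.sum _ fun k hk => ?_
  rcases le_or_gt k K.length with hk | hk
  · simp only [List.take_append_of_le_length hk, List.drop_append_of_le_length hk]
    exact h₂ _ _ _
  · obtain ⟨m, rfl⟩ := Nat.exists_eq_add_of_lt hk
    have e1 (a : A) : (K ++ a :: L).take (K.length + m + 1) = K ++ a :: L.take m := by
      rw [add_assoc, List.take_length_add_append]; simp
    have e2 (a : A) : (K ++ a :: L).drop (K.length + m + 1) = L.drop m := by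
      rw [add_assoc, List.drop_length_add_append]; simp
    simp only [e1, e2]
    exact h₁ _ _ _

theorem mul (h : IsMultiOp P r φ) (h' : IsMultiOp P s ψ) :
    IsMultiOp P (max r s) (φ * ψ) :=
  csum (fun _ K' L' => ((h K' L').mul_right _).mono (le_max_left _ _))
    (fun _ K' L' => ((h' K' L').mul_left _).mono (le_max_right _ _))

theorem hd (h : IsMultiOp P r φ) (h' : IsMultiOp P s ψ) : IsMultiOp P (r + s) (hd φ ψ) :=
  csum (fun L K' L' => (h [] L).comp (h' K' L'))
    (fun K K' L' => (h (ψ K :: K') L').mono (Nat.le_add_right _ _))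

theorem isOp_ins_DD (h : IsMultiOp P r φ) (ε : ℝ) (K M L : List A) :
    IsOp P r (fun a => Conv.ins ε (Conv.DD (K ++ a :: M) φ) ψ L) := by
  simp only [ins_eq_sum, DD_apply]
  refine IsOp.sum _ fun i _ => IsOp.sum _ fun l _ => IsOp.smul _ ?_
  simpa using h K (M ++ (L.take i ++ ψ ((L.drop i).take l) :: L.drop (i + l)))

theorem ins (ε : ℝ) (h : IsMultiOp P r φ) (h' : IsMultiOp P s ψ) :
    IsMultiOp P (r + s) (ins ε φ ψ) := by
  rw [ins_eq_csum]
  refine csum (fun L K' L' => ?_) (fun K => ((h.DD K).hd h').smul _)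
  simp only [List.length_append, List.length_cons, Conv.smul_apply, Conv.hd, Conv.csum, D_DD]
  refine IsOp.smul _ (IsOp.sum _ fun i _ => ?_)
  simpa [DD_apply] using (h K' (L' ++ ψ (L.take i) :: L.drop i)).mono (Nat.le_add_right r s)

theorem hd₂ (η : ℝ) (h : IsMultiOp P r φ) (h' : IsMultiOp P s ψ) (h'' : IsMultiOp P t χ) :
    IsMultiOp P (r + s + t) (hd₂ η φ ψ χ) := by
  refine csum (fun L K' L' => ?_) (fun K => IsMultiOp.smul _ ?_)
  · simp only [List.length_append, List.length_cons, Conv.smul_apply]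
    exact ((h.isOp_ins_DD η [] [] L).comp (h' K' L')).smul _ |>.mono (by omega)
  · exact ((h.DD [ψ K]).ins η h'').mono (by omega)

theorem ins₂ (ε η : ℝ) (h : IsMultiOp P r φ) (h' : IsMultiOp P s ψ) (h'' : IsMultiOp P t χ) :
    IsMultiOp P (r + s + t) (ins₂ ε η φ ψ χ) := by
  rw [ins₂_eq_csum]
  refine csum (fun L K' L' => ?_) (fun K => ((h.DD K).hd₂ η h' h'').smul _)
  simp only [List.length_append, List.length_cons, Conv.smul_apply, Conv.hd₂, Conv.csum, D_DD,
    List.append_assoc, List.cons_append]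
  exact IsOp.smul _ (IsOp.sum _ fun i _ => ((h.isOp_ins_DD η K' _ _).smul _).mono (by omega))

theorem comp (k : ℤ) (h : IsMultiOp P r φ) : IsMultiOp P r (comp k φ) := fun K L => by
  change IsOp P r fun a => if ((K ++ a :: L).length : ℤ) = k then φ (K ++ a :: L) else 0
  simp only [List.length_append, List.length_cons]
  split_ifs
  · exact h K L
  · exact .zero r

end IsMultiOp

/-- The function on words vanishes on words of length greater than `N`. -/
def VanishesAbove (N : ℕ) (φ : Conv A A) : Prop := ∀ L : List A, N < L.length → φ L = 0

namespace VanishesAbove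

variable {N M Q : ℕ} {φ ψ χ : Conv A A}

theorem csum {Φ : List A → Conv A A} (h₁ : ∀ K : List A, N < K.length → ∀ L, Φ K L = 0)
    (h₂ : ∀ K, VanishesAbove M (Φ K)) : VanishesAbove (N + M) (csum Φ) := by
  refine fun L hL => Finset.sum_eq_zero fun k hk => ?_
  rcases lt_or_ge N (L.take k).length with h | h
  · exact h₁ _ h _
  · refine h₂ _ _ ?_
    simp at h ⊢
    omega

theorem smul (c : ℝ) (h : VanishesAbove N φ) : VanishesAbove N (c • φ) := fun L hL => by
  rw [Conv.smul_apply, h L hL, smul_zero]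

theorem DD (K : List A) (h : VanishesAbove N φ) : VanishesAbove N (DD K φ) := fun L hL =>
  h _ (by simp; omega)

theorem DD_eq_zero {K : List A} (h : VanishesAbove N φ) (hK : N < K.length) : Conv.DD K φ = 0 :=
  Conv.ext fun L => h _ (by simp; omega)

theorem mul (h : VanishesAbove N φ) (h' : VanishesAbove M ψ) : VanishesAbove (N + M) (φ * ψ) :=
  csum (fun K hK L => by rw [Conv.smul_apply, h K hK, zero_smul])
    (fun K L hL => by rw [Conv.smul_apply, h' L hL, smul_zero])

theorem D_zero (h : φ ∈ ML A) : D 0 φ = 0 := Conv.ext fun L => ML_zero h [] L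

theorem hd (hφ : φ ∈ ML A) (h : VanishesAbove N φ) (h' : VanishesAbove M ψ) :
    VanishesAbove (M + N) (hd φ ψ) :=
  csum (fun K hK L => by rw [h' K hK, D_zero hφ]; rfl) (fun K => h.DD [ψ K])

theorem DD_mem_ML (K : List A) (hφ : φ ∈ ML A) : Conv.DD K φ ∈ ML A := fun K' L a b s t => by
  simpa [DD_apply] using hφ (K ++ K') L a b s t

theorem ins (ε : ℝ) (hφ : φ ∈ ML A) (h : VanishesAbove N φ) (h' : VanishesAbove M ψ) :
    VanishesAbove (N + (M + N)) (ins ε φ ψ) := by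
  rw [ins_eq_csum]
  refine csum (fun K hK L => ?_) (fun K => ((h.DD K).hd (DD_mem_ML K hφ) h').smul _)
  rw [h.DD_eq_zero hK, ← zero_smul ℝ (0 : Conv A A), hd_smul]
  simp

theorem hd₂ (η : ℝ) (hφ : φ ∈ ML A) (h : VanishesAbove N φ) (h' : VanishesAbove M ψ)
    (h'' : VanishesAbove Q χ) : VanishesAbove (M + (N + (Q + N))) (hd₂ η φ ψ χ) := by
  refine csum (fun K hK L => ?_)
    (fun K => (VanishesAbove.ins η (DD_mem_ML [ψ K] hφ) (h.DD [ψ K]) h'').smul _)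
  rw [h' K hK, D_zero hφ, ins_zero_left]
  simp

theorem ins₂ (ε η : ℝ) (hφ : φ ∈ ML A) (h : VanishesAbove N φ) (h' : VanishesAbove M ψ)
    (h'' : VanishesAbove Q χ) : VanishesAbove (N + (M + (N + (Q + N)))) (ins₂ ε η φ ψ χ) := by
  rw [ins₂_eq_csum]
  refine csum (fun K hK L => ?_) (fun K => ((h.DD K).hd₂ η (DD_mem_ML K hφ) h' h'').smul _)
  rw [h.DD_eq_zero hK, ← zero_smul ℝ (0 : Conv A A), hd₂_smul]
  simp

end VanishesAbove

/-- The space of multidifferential cochains that commute in every argument with the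
multiplications by the elements of `P` is closed under all operations. -/
theorem braceClosed_of_mem_iff {P : Set A} {S : Submodule ℝ (Cochain A)}
    (hS : ∀ φ : Conv A A, φ ∈ S ↔ (∃ r, IsMultiOp P r φ) ∧ ∃ N, VanishesAbove N φ) :
    BraceClosed S where
  le_HC φ h := by
    obtain ⟨⟨r, hr⟩, N, hN⟩ := (hS φ).1 h
    exact ⟨hr.mem_ML, N, hN⟩
  one_mem := (hS _).2 ⟨⟨0, .one⟩, 0, fun L hL => by
    cases L with
    | nil => simp at hL
    | cons a L => simp⟩
  mul_mem {φ ψ} h h' := by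
    obtain ⟨⟨r, hr⟩, N, hN⟩ := (hS φ).1 h
    obtain ⟨⟨r', hr'⟩, N', hN'⟩ := (hS ψ).1 h'
    exact (hS _).2 ⟨⟨_, hr.mul hr'⟩, _, hN.mul hN'⟩
  tw_mem ε {φ} h := by
    obtain ⟨⟨r, hr⟩, N, hN⟩ := (hS φ).1 h
    exact (hS _).2 ⟨⟨_, hr.tw ε⟩, N, fun L hL => by rw [tw_apply, hN L hL, smul_zero]⟩
  ins_mem ε {φ ψ} h h' := by
    obtain ⟨⟨r, hr⟩, N, hN⟩ := (hS φ).1 h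
    obtain ⟨⟨r', hr'⟩, N', hN'⟩ := (hS ψ).1 h'
    exact (hS _).2 ⟨⟨_, hr.ins ε hr'⟩, _, hN.ins ε hr.mem_ML hN'⟩
  ins₂_mem ε η {φ ψ χ} h h' h'' := by
    obtain ⟨⟨r, hr⟩, N, hN⟩ := (hS φ).1 h
    obtain ⟨⟨r', hr'⟩, N', hN'⟩ := (hS ψ).1 h'
    obtain ⟨⟨r'', hr''⟩, N'', hN''⟩ := (hS χ).1 h''
    exact (hS _).2 ⟨⟨_, hr.ins₂ ε η hr' hr''⟩, _, hN.ins₂ ε η hr.mem_ML hN' hN''⟩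
  comp_mem k {φ} h := by
    obtain ⟨⟨r, hr⟩, N, hN⟩ := (hS φ).1 h
    refine (hS _).2 ⟨⟨_, hr.comp k⟩, N, fun L hL => ?_⟩
    change (if (L.length : ℤ) = k then φ L else 0) = 0
    rw [hN L hL, ite_self]

/-- The orders of a differential cochain can be bounded uniformly, as it has only finitely many
components. -/
theorem mem_HCdiff_iff (φ : Conv A A) :
    φ ∈ HCdiff A ↔ (∃ r, IsMultiOp ∅ r φ) ∧ ∃ N, VanishesAbove N φ := by
  constructor
  · rintro ⟨⟨hφ, N, hN⟩, hd⟩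
    choose r hr using hd
    refine ⟨⟨(Finset.range (N + 1)).sup r, fun K L => ⟨hφ K L, ?_, by simp⟩⟩, N, hN⟩
    rcases lt_or_ge N (K.length + 1 + L.length) with h | h
    · have e (a : A) : φ (K ++ a :: L) = 0 := hN _ (by simp; omega)
      simp only [e]
      exact .zero _
    · exact (hr _ K L rfl).mono (Finset.le_sup (f := r) (by simp; omega))
  · rintro ⟨⟨r, hr⟩, N, hN⟩
    exact ⟨⟨hr.mem_ML, N, hN⟩, fun k => ⟨r, fun K L _ => (hr K L).order⟩⟩

theorem braceClosed_HCdiff : BraceClosed (HCdiff A) := braceClosed_of_mem_iff mem_HCdiff_iff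

theorem braceClosed_HCdiff_inf_HClinear {C : Type*} [CommRing C] (π : C →+* A) :
    BraceClosed (HCdiff A ⊓ HClinear π) := by
  refine braceClosed_of_mem_iff (P := Set.range π) fun φ => ?_
  constructor
  · rintro ⟨h, hl⟩
    obtain ⟨⟨r, hr⟩, hN⟩ := (mem_HCdiff_iff φ).1 h
    refine ⟨⟨r, fun K L => ⟨(hr K L).linear, (hr K L).order, ?_⟩⟩, hN⟩
    rintro _ ⟨u, rfl⟩ a
    exact hl K L u a
  · rintro ⟨⟨r, hr⟩, hN⟩
    refine ⟨(mem_HCdiff_iff φ).2 ⟨⟨r, fun K L => ⟨(hr K L).linear, (hr K L).order, by simp⟩⟩, hN⟩,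
      fun K L u a => (hr K L).comm _ ⟨u, rfl⟩ a⟩

end DiffCochains

/-! ### Hadamard's lemma with parameters -/

section Hadamard

variable {V W : Type*} [NormedAddCommGroup V] [NormedSpace ℝ V] [FiniteDimensional ℝ V]
  [NormedAddCommGroup W] [NormedSpace ℝ W] [FiniteDimensional ℝ W]

theorem hasFDerivAt_parametric_integral {f : V × ℝ → ℝ} (hf : ContDiff ℝ ∞ f) (x : V) :
    HasFDerivAt (fun x => ∫ t in (0 : ℝ)..1, f (x, t))
      (∫ t in (0 : ℝ)..1, (fderiv ℝ f (x, t)).comp (.inl ℝ V ℝ)) x := by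
  have : ProperSpace V := FiniteDimensional.proper ℝ V
  have hF' : Continuous fun p : V × ℝ => (fderiv ℝ f p).comp (.inl ℝ V ℝ) :=
    (hf.continuous_fderiv (by simp)).clm_comp continuous_const
  obtain ⟨C, hC⟩ := ((isCompact_closedBall x 1).prod (isCompact_Icc (a := (0 : ℝ)) (b := 1))
    ).exists_bound_of_continuousOn hF'.continuousOn
  refine hasFDerivAt_integral_of_dominated_of_fderiv_le'' (F := fun x t => f (x, t))
    (F' := fun x t => (fderiv ℝ f (x, t)).comp (.inl ℝ V ℝ)) (bound := fun _ => C)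
    (Metric.closedBall_mem_nhds x one_pos) (.of_forall fun y => ?_) ?_ ?_ ?_ ?_ ?_
  · exact (hf.continuous.comp (by fun_prop : Continuous fun t : ℝ => (y, t))).aestronglyMeasurable
  · exact (hf.continuous.comp (by fun_prop : Continuous fun t : ℝ => (x, t))).intervalIntegrable _ _
  · exact (hF'.comp (by fun_prop : Continuous fun t : ℝ => (x, t))).aestronglyMeasurable
  · refine (MeasureTheory.ae_restrict_iff' measurableSet_uIoc).2 (.of_forall fun t ht y hy => ?_)
    rw [Set.uIoc_of_le zero_le_one] at ht
    exact hC (y, t) ⟨hy, ht.1.le, ht.2⟩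
  · exact intervalIntegrable_const
  · refine .of_forall fun t y _ => ?_
    exact ((hf.differentiable (by simp)) (y, t)).hasFDerivAt.comp y (hasFDerivAt_prodMk_left y t)

/-- The integral over `[0, 1]` of a smooth function depends smoothly on the parameters. -/
theorem contDiff_parametric_integral {f : V × ℝ → ℝ} (hf : ContDiff ℝ ∞ f) :
    ContDiff ℝ ∞ (fun x => ∫ t in (0 : ℝ)..1, f (x, t)) := by
  refine contDiff_infty.2 fun n => ?_
  induction n generalizing f with
  | zero =>
    rw [Nat.cast_zero, contDiff_zero]
    exact intervalIntegral.continuous_parametric_intervalIntegral_of_continuous'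
      (f := fun x t => f (x, t)) hf.continuous 0 1
  | succ n ih =>
    rw [Nat.cast_succ, contDiff_succ_iff_fderiv_apply]
    refine ⟨fun x => (hasFDerivAt_parametric_integral hf x).differentiableAt, by simp, fun y => ?_⟩
    have e : (fun x => fderiv ℝ (fun x => ∫ t in (0 : ℝ)..1, f (x, t)) x y) =
        fun x => ∫ t in (0 : ℝ)..1, fderiv ℝ f (x, t) (y, 0) := by
      funext x
      rw [(hasFDerivAt_parametric_integral hf x).fderiv, ContinuousLinearMap.intervalIntegral_apply]
      · simp
      · refine Continuous.intervalIntegrable ?_ _ _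
        exact ((hf.continuous_fderiv (by simp)).comp
          (by fun_prop : Continuous fun t : ℝ => (x, t))).clm_comp continuous_const
    rw [e]
    exact ih (f := fun p => fderiv ℝ f p (y, 0))
      ((hf.fderiv_right (m := ∞) (by simp)).clm_apply contDiff_const)

/-- **Hadamard's lemma** with parameters: a smooth function on `V × W` that vanishes on
`{y₀} × W` is a combination of the coordinates of `y - y₀` with smooth coefficients. -/
theorem exists_hadamard {ι : Type*} [Fintype ι] (b : Module.Basis ι ℝ V) {f : V × W → ℝ}
    (hf : ContDiff ℝ ∞ f) (y₀ : V) (h₀ : ∀ w, f (y₀, w) = 0) :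
    ∃ g : ι → V × W → ℝ, (∀ i, ContDiff ℝ ∞ (g i)) ∧
      ∀ y w, f (y, w) = ∑ i, b.repr (y - y₀) i * g i (y, w) := by
  have hf' : ContDiff ℝ ∞ (fderiv ℝ f) := hf.fderiv_right (m := ∞) (by simp)
  refine ⟨fun i p => ∫ t in (0 : ℝ)..1, fderiv ℝ f (y₀ + t • (p.1 - y₀), p.2) (b i, 0),
    fun i => ?_, fun y w => ?_⟩
  · refine contDiff_parametric_integral
      (f := fun q : (V × W) × ℝ => fderiv ℝ f (y₀ + q.2 • (q.1.1 - y₀), q.1.2) (b i, 0)) ?_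
    refine ContDiff.clm_apply (hf'.comp ?_) contDiff_const
    fun_prop
  · have hd (t : ℝ) : HasDerivAt (fun t : ℝ => f (y₀ + t • (y - y₀), w))
        (fderiv ℝ f (y₀ + t • (y - y₀), w) (y - y₀, 0)) t := by
      refine ((hf.differentiable (by simp)) _).hasFDerivAt.comp_hasDerivAt t ?_
      refine HasDerivAt.prodMk ?_ (hasDerivAt_const t w)
      simpa using ((hasDerivAt_id t).smul_const (y - y₀)).const_add y₀
    have hc (v : V × W) :
        Continuous fun t : ℝ => fderiv ℝ f (y₀ + t • (y - y₀), w) v := by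
      have := hf'.continuous
      fun_prop
    have ftc := intervalIntegral.integral_eq_sub_of_hasDerivAt (a := 0) (b := 1)
      (fun t _ => hd t) ((hc _).intervalIntegrable _ _)
    have e : (y - y₀, (0 : W)) = ∑ i, b.repr (y - y₀) i • (b i, (0 : W)) := by
      refine Prod.ext ?_ ?_
      · rw [Prod.fst_sum]; simpa using (b.sum_repr (y - y₀)).symm
      · rw [Prod.snd_sum]; simp
    simp only [one_smul, zero_smul, add_zero, h₀, sub_zero, add_sub_cancel] at ftc
    rw [← ftc, e]
    simp only [map_sum, map_smul, smul_eq_mul]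
    rw [intervalIntegral.integral_finsetSum]
    · simp only [intervalIntegral.integral_const_mul]
    · exact fun i _ => (continuous_const.mul (hc (b i, 0))).intervalIntegrable _ _

end Hadamard

/-! ### Functions on the total space and their restrictions to a fiber -/

section Restriction

set_option linter.unusedSectionVars false

variable {EB : Type*} [NormedAddCommGroup EB] [NormedSpace ℝ EB] [FiniteDimensional ℝ EB]
  {M : Type*} [TopologicalSpace M] [T2Space M] [ChartedSpace EB M] [IsManifold 𝓘(ℝ, EB) ∞ M]
  {F : Type*} [NormedAddCommGroup F] [NormedSpace ℝ F] [FiniteDimensional ℝ F]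
  {E : M → Type*} [TopologicalSpace (Bundle.TotalSpace F E)] [∀ x, TopologicalSpace (E x)]
  [∀ x, AddCommGroup (E x)] [∀ x, Module ℝ (E x)]
  [FiberBundle F E] [VectorBundle ℝ F E] [ContMDiffVectorBundle ∞ F E 𝓘(ℝ, EB)]

/-- A bump function at `p` is *adapted* if its chart ball lies over the domain of the trivialization
at `p`. -/
def Adapted (F : Type*) [NormedAddCommGroup F] [NormedSpace ℝ F]
    (E : M → Type*) [TopologicalSpace (Bundle.TotalSpace F E)] [∀ x, TopologicalSpace (E x)]
    [∀ x, AddCommGroup (E x)] [∀ x, Module ℝ (E x)] [FiberBundle F E]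
    {p : M} (χ : SmoothBumpFunction 𝓘(ℝ, EB) p) : Prop :=
  (extChartAt 𝓘(ℝ, EB) p).symm '' (Metric.closedBall (extChartAt 𝓘(ℝ, EB) p p) χ.rOut) ⊆
    (trivializationAt F E p).baseSet

variable (EB F E) in
theorem exists_adapted (p : M) : ∃ χ : SmoothBumpFunction 𝓘(ℝ, EB) p, Adapted F E χ := by
  have h : (nhds p).HasBasis (fun _ : SmoothBumpFunction 𝓘(ℝ, EB) p => True) fun f =>
      (extChartAt 𝓘(ℝ, EB) p).symm ''
        (Metric.closedBall (extChartAt 𝓘(ℝ, EB) p p) f.rOut ∩ Set.range 𝓘(ℝ, EB)) := by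
    rw [← map_extChartAt_symm_nhdsWithin_range (I := 𝓘(ℝ, EB)) p]
    exact SmoothBumpFunction.nhdsWithin_range_basis.map _
  obtain ⟨χ, -, hχ⟩ := h.mem_iff.1 ((trivializationAt F E p).open_baseSet.mem_nhds
    (FiberBundle.mem_baseSet_trivializationAt' p))
  exact ⟨χ, by simpa [Adapted] using hχ⟩

namespace Adapted

variable {p : M} {χ : SmoothBumpFunction 𝓘(ℝ, EB) p} (hχ : Adapted F E χ)

include hχ

theorem tsupport_subset : tsupport χ ⊆ (trivializationAt F E p).baseSet :=
  χ.tsupport_subset_symm_image_closedBall.trans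
    ((Set.image_mono Set.inter_subset_left).trans hχ)

/-- A smooth function of the chart of the base and of the fiber coordinate, cut off by a bump
function on the base, as a smooth function on the total space. -/
theorem exists_extension {g : EB × F → ℝ} (hg : ContDiff ℝ ∞ g) :
    ∃ G : CInfTotal EB F E, ∀ v : Bundle.TotalSpace F E, G v =
      χ v.proj * g (extChartAt 𝓘(ℝ, EB) p v.proj, (trivializationAt F E p v).2) := by
  refine ⟨⟨fun v => χ v.proj * g (extChartAt 𝓘(ℝ, EB) p v.proj, (trivializationAt F E p v).2),
    fun v => ?_⟩, fun v => rfl⟩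
  have hπ : ContMDiffAt (𝓘(ℝ, EB).prod 𝓘(ℝ, F)) 𝓘(ℝ, EB) ∞
      (fun v : Bundle.TotalSpace F E => v.proj) v := Bundle.contMDiffAt_proj E
  have hχv : ContMDiffAt (𝓘(ℝ, EB).prod 𝓘(ℝ, F)) 𝓘(ℝ, ℝ) ∞
      (fun v : Bundle.TotalSpace F E => χ v.proj) v := χ.contMDiffAt.comp v hπ
  by_cases hv : v.proj ∈ tsupport χ
  · have hb : v ∈ (trivializationAt F E p).source :=
      (Bundle.Trivialization.mem_source _).2 (hχ.tsupport_subset hv)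
    have h1 : ContMDiffAt (𝓘(ℝ, EB).prod 𝓘(ℝ, F)) 𝓘(ℝ, EB) ∞
        (fun v : Bundle.TotalSpace F E => extChartAt 𝓘(ℝ, EB) p v.proj) v :=
      (contMDiffAt_extChartAt' (χ.tsupport_subset_chartAt_source hv)).comp v hπ
    have h2 : ContMDiffAt (𝓘(ℝ, EB).prod 𝓘(ℝ, F)) 𝓘(ℝ, F) ∞
        (fun v : Bundle.TotalSpace F E => (trivializationAt F E p v).2) v :=
      (((trivializationAt F E p).contMDiffOn (IB := 𝓘(ℝ, EB)) (n := ∞)).contMDiffAt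
        ((trivializationAt F E p).open_source.mem_nhds hb)).snd
    exact hχv.mul (hg.contMDiff.contMDiffAt.comp v (h1.prodMk_space h2))
  · refine (contMDiffAt_const (c := (0 : ℝ))).congr_of_eventuallyEq ?_
    have hc : Continuous fun v : Bundle.TotalSpace F E => v.proj :=
      (Bundle.contMDiff_proj E (IB := 𝓘(ℝ, EB)) (n := ∞)).continuous
    filter_upwards [((isClosed_tsupport χ).preimage hc).isOpen_compl.mem_nhds hv] with w hw
    rw [image_eq_zero_of_notMem_tsupport hw, zero_mul]

/-- A smooth function on the total space, written in the chart of the base and the fiber coordinate,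
and cut off by a bump function on the base. -/
theorem contDiff_chart (f : CInfTotal EB F E) : ContDiff ℝ ∞ fun q : EB × F =>
    χ.toContDiffBump q.1 * f ((trivializationAt F E p).toOpenPartialHomeomorph.symm
      ((extChartAt 𝓘(ℝ, EB) p).symm q.1, q.2)) := by
  rw [← contMDiff_iff_contDiff, modelWithCornersSelf_prod, ← chartedSpaceSelf_prod]
  rintro ⟨y, w⟩
  have hb : ContMDiffAt (𝓘(ℝ, EB).prod 𝓘(ℝ, F)) 𝓘(ℝ, ℝ) ∞
      (fun q : EB × F => χ.toContDiffBump q.1) (y, w) :=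
    χ.toContDiffBump.contDiff.contMDiff.contMDiffAt.comp (y, w) contMDiffAt_fst
  by_cases hy : y ∈ Metric.closedBall (extChartAt 𝓘(ℝ, EB) p p) χ.rOut
  · have hy' : y ∈ (extChartAt 𝓘(ℝ, EB) p).target := χ.closedBall_subset ⟨hy, by simp⟩
    have h1 : ContMDiffAt (𝓘(ℝ, EB).prod 𝓘(ℝ, F)) 𝓘(ℝ, EB) ∞
        (fun q : EB × F => (extChartAt 𝓘(ℝ, EB) p).symm q.1) (y, w) :=
      ((contMDiffOn_extChartAt_symm (n := ∞) p).contMDiffAt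
        (extChartAt_target_mem_nhds' hy')).comp (y, w) contMDiffAt_fst
    have h2 : ContMDiffAt (𝓘(ℝ, EB).prod 𝓘(ℝ, F)) (𝓘(ℝ, EB).prod 𝓘(ℝ, F)) ∞
        (fun q : EB × F => ((extChartAt 𝓘(ℝ, EB) p).symm q.1, q.2)) (y, w) :=
      h1.prodMk contMDiffAt_snd
    have hm : ((extChartAt 𝓘(ℝ, EB) p).symm y, w) ∈ (trivializationAt F E p).target :=
      (Bundle.Trivialization.mem_target _).2 (hχ ⟨y, hy, rfl⟩)
    have h3 := ((trivializationAt F E p).contMDiffOn_symm (IB := 𝓘(ℝ, EB)) (n := ∞)).contMDiffAt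
      ((trivializationAt F E p).open_target.mem_nhds hm)
    have h4 := (f.contMDiff.contMDiffAt.comp _ h3).comp (y, w) h2
    exact hb.mul h4
  · have h0 : ContMDiffAt (𝓘(ℝ, EB).prod 𝓘(ℝ, F)) 𝓘(ℝ, ℝ) ∞ (fun _ : EB × F => (0 : ℝ)) (y, w) :=
      contMDiffAt_const
    refine h0.congr_of_eventuallyEq ?_
    have : IsOpen {q : EB × F | q.1 ∉ Metric.closedBall (extChartAt 𝓘(ℝ, EB) p p) χ.rOut} :=
      (Metric.isClosed_closedBall.preimage continuous_fst).isOpen_compl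
    filter_upwards [this.mem_nhds hy] with q hq
    rw [χ.toContDiffBump.zero_of_le_dist (by simpa using (not_le.1 hq).le), zero_mul]

end Adapted

variable (EB F E) in
/-- The restriction of functions to a fiber, as a homomorphism of algebras. -/
noncomputable def restrictHom (p : M) : CInfTotal EB F E →ₐ[ℝ] smoothFun (E p) where
  toFun := restrict EB F E p
  map_one' := rfl
  map_mul' _ _ := rfl
  map_zero' := rfl
  map_add' _ _ := rfl
  commutes' _ := rfl

theorem restrict_surjective (p : M) : Function.Surjective (restrictHom EB F E p) := by
  intro f
  obtain ⟨χ, hχ⟩ := exists_adapted EB F E p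
  have hp : p ∈ (trivializationAt F E p).baseSet := FiberBundle.mem_baseSet_trivializationAt' p
  let l : E p ≃ₗ[ℝ] F := (trivializationAt F E p).linearEquivAt ℝ p hp
  let b := Module.finBasis ℝ F
  have hg : ContDiff ℝ ∞ fun q : EB × F => f.1 (l.symm q.2) := by
    have h := (f.2 _ (b.equivFun.symm.trans l.symm)).comp
      ((b.equivFun.toLinearMap.toContinuousLinearMap.contDiff (n := ∞)).comp
        (contDiff_snd (E := EB) (F := F)))
    refine (congrArg (ContDiff ℝ ∞) (funext fun q => ?_)).mp h
    change f.1 (l.symm (b.equivFun.symm (b.equivFun q.2))) = f.1 (l.symm q.2)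
    rw [LinearEquiv.symm_apply_apply]
  obtain ⟨G, hG⟩ := hχ.exists_extension hg
  refine ⟨G, Subtype.ext (funext fun v => ?_)⟩
  change G ⟨p, v⟩ = f.1 v
  rw [hG]
  change χ p * f.1 (l.symm (l v)) = f.1 v
  rw [χ.eq_one, one_mul, l.symm_apply_apply]

/-- The functions on the total space that vanish on the fiber over `p` form the ideal generated by
the functions on the base that vanish at `p`. -/
theorem mem_span_of_restrict_eq_zero (p : M) {f : CInfTotal EB F E}
    (hf : restrictHom EB F E p f = 0) :
    f ∈ Ideal.span (pullback EB F E '' {u : CInfBase EB M | u p = 0}) := by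
  obtain ⟨χ, hχ⟩ := exists_adapted EB F E p
  have hf' (v : Bundle.TotalSpace F E) (hv : v.proj = p) : f v = 0 := by
    obtain ⟨x, v⟩ := v
    obtain rfl : x = p := hv
    exact congrFun (congrArg Subtype.val hf) v
  have hp : p ∈ (trivializationAt F E p).baseSet := FiberBundle.mem_baseSet_trivializationAt' p
  let b := Module.finBasis ℝ EB
  obtain ⟨g, hg, hfg⟩ := exists_hadamard b (hχ.contDiff_chart f) (extChartAt 𝓘(ℝ, EB) p p) (by
    intro w
    rw [hf', mul_zero]
    simp only [extChartAt_to_inv]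
    exact Bundle.Trivialization.proj_symm_apply' _ hp)
  choose G hG using fun i => hχ.exists_extension (hg i)
  -- The coordinate functions of the base, centered at `p` and cut off.
  let u (i) : CInfBase EB M :=
    ⟨fun x => χ x • b.repr (extChartAt 𝓘(ℝ, EB) p x - extChartAt 𝓘(ℝ, EB) p p) i,
      χ.contMDiff_smul (by
        have : ContDiff ℝ ∞ fun y : EB => b.repr (y - extChartAt 𝓘(ℝ, EB) p p) i :=
          ((b.coord i).toContinuousLinearMap.contDiff).comp (contDiff_id.sub contDiff_const)
        exact this.contMDiff.comp_contMDiffOn contMDiffOn_extChartAt)⟩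
  let c : CInfBase EB M := ⟨fun x => χ x, χ.contMDiff⟩
  -- By Hadamard's lemma `χ * f` is a combination of centered coordinates on the support of `χ`;
  -- multiplied by `χ ^ 2` this extends to the total space, and `1 - χ ^ 3` vanishes at `p`.
  have key : f = pullback EB F E (1 - c ^ 3) * f + ∑ i, pullback EB F E (u i) * G i := by
    refine ContMDiffMap.ext fun v => ?_
    have hsum : (∑ i, pullback EB F E (u i) * G i : CInfTotal EB F E) v =
        ∑ i, u i v.proj * G i v := by
      rw [← ContMDiffMap.coeFnRingHom_apply, map_sum, Finset.sum_apply]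
      rfl
    change f v = (1 - χ v.proj ^ 3) * f v + (∑ i, pullback EB F E (u i) * G i : CInfTotal EB F E) v
    rw [hsum]
    simp only [hG]
    change f v = (1 - χ v.proj ^ 3) * f v + ∑ i, (χ v.proj *
      b.repr (extChartAt 𝓘(ℝ, EB) p v.proj - extChartAt 𝓘(ℝ, EB) p p) i) * _
    by_cases hv : χ v.proj = 0
    · simp [hv]
    · have hv' : v.proj ∈ tsupport χ := subset_closure hv
      have e1 : χ.toContDiffBump (extChartAt 𝓘(ℝ, EB) p v.proj) = χ v.proj :=
        (χ.eqOn_source (χ.tsupport_subset_chartAt_source hv')).symm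
      have hvs : v ∈ (trivializationAt F E p).source :=
        (Bundle.Trivialization.mem_source _).2 (hχ.tsupport_subset hv')
      have e2 : (trivializationAt F E p).toOpenPartialHomeomorph.symm
          ((extChartAt 𝓘(ℝ, EB) p).symm (extChartAt 𝓘(ℝ, EB) p v.proj),
            (trivializationAt F E p v).2) = v := by
        rw [(extChartAt 𝓘(ℝ, EB) p).left_inv (χ.tsupport_subset_extChartAt_source hv'),
          (trivializationAt F E p).mk_proj_snd hvs]
        exact (trivializationAt F E p).toOpenPartialHomeomorph.left_inv hvs
      have e3 := hfg (extChartAt 𝓘(ℝ, EB) p v.proj) (trivializationAt F E p v).2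
      simp only [e1, e2] at e3
      have e4 : ∀ i, (χ v.proj *
          b.repr (extChartAt 𝓘(ℝ, EB) p v.proj - extChartAt 𝓘(ℝ, EB) p p) i) *
          (χ v.proj * g i (extChartAt 𝓘(ℝ, EB) p v.proj, (trivializationAt F E p v).2)) =
          χ v.proj ^ 2 * (b.repr (extChartAt 𝓘(ℝ, EB) p v.proj - extChartAt 𝓘(ℝ, EB) p p) i *
            g i (extChartAt 𝓘(ℝ, EB) p v.proj, (trivializationAt F E p v).2)) := fun i => by ring
      simp only [e4]
      rw [← Finset.mul_sum, ← e3]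
      ring
  have mem {w : CInfBase EB M} (hw : w p = 0) :
      pullback EB F E w ∈ Ideal.span (pullback EB F E '' {u : CInfBase EB M | u p = 0}) :=
    Ideal.subset_span ⟨w, hw, rfl⟩
  rw [key]
  refine Ideal.add_mem _ (Ideal.mul_mem_right _ _ (mem ?_))
    (Ideal.sum_mem _ fun i _ => Ideal.mul_mem_right _ _ (mem ?_))
  · change 1 - χ p ^ 3 = 0
    rw [χ.eq_one]; norm_num
  · change χ p • b.repr (extChartAt 𝓘(ℝ, EB) p p - extChartAt 𝓘(ℝ, EB) p p) i = 0
    simp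

end Restriction

/-! ### Cochains along a surjective homomorphism of algebras -/

section Descent

set_option linter.unusedSectionVars false

variable {A B : Type*} [CommRing A] [Algebra ℝ A] [CommRing B] [Algebra ℝ B] {q : A →ₐ[ℝ] B}

/-- The cochain `ψ` of `B` is induced by the cochain `φ` of `A` along the homomorphism `q`. -/
def IsImage (q : A →ₐ[ℝ] B) (φ : Cochain A) (ψ : Cochain B) : Prop :=
  ∀ L : List A, ψ (L.map q) = q (φ L)

namespace IsImage

variable {φ φ' : Cochain A} {ψ ψ' : Cochain B}

theorem unit : IsImage q unitCochain unitCochain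
  | [] => (map_one q).symm
  | _ :: _ => (map_zero q).symm

theorem cup (h : IsImage q φ ψ) (h' : IsImage q φ' ψ') :
    IsImage q (VertHH.cup φ φ') (VertHH.cup ψ ψ') := fun L => by
  simp only [VertHH.cup, map_sum, map_mul, ← h _, ← h' _, List.map_take, List.map_drop,
    List.length_map]

theorem circ (h : IsImage q φ ψ) (h' : IsImage q φ' ψ') :
    IsImage q (VertHH.circ φ φ') (VertHH.circ ψ ψ') := fun L => by
  simp only [VertHH.circ, map_sum, map_mul, map_pow, map_neg, map_one, ← h _, ← h' _,
    List.map_take, List.map_drop, List.length_map, List.map_append, List.map_cons]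

theorem gBracket (k l : ℕ) (h : IsImage q φ ψ) (h' : IsImage q φ' ψ') :
    IsImage q (VertHH.gBracket k l φ φ') (VertHH.gBracket k l ψ ψ') := fun L => by
  simp only [VertHH.gBracket, Pi.sub_apply, Pi.smul_apply, map_sub, map_smul, h.circ h' L,
    h'.circ h L]

theorem hochschild (h : IsImage q φ ψ) :
    IsImage q (VertHH.hochschild A φ) (VertHH.hochschild B ψ)
  | [] => (map_zero q).symm
  | a :: T => by
    change hochschildFun ψ (q a :: T.map q) = q (hochschildFun φ (a :: T))
    simp only [hochschildFun, map_add, map_sum, map_mul, map_pow, map_neg, map_one, ← h _,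
      List.map_take, List.map_drop, List.length_map, List.map_append, List.map_cons,
      map_list_prod, List.map_dropLast]
    congr 3
    exact List.getLast_map (l := a :: T) (by simp)

theorem isHomog (hq : Function.Surjective q) (h : IsImage q φ ψ) {k : ℤ} (hφ : IsHomog k φ) :
    IsHomog k ψ := fun L hL => by
  obtain ⟨L, rfl⟩ := List.map_surjective_iff.2 hq L
  rw [h L, hφ L (by simpa using hL), map_zero]

theorem diffOrderLT (hq : Function.Surjective q) {r : ℕ} {D : A → A} {D' : B → B}
    (h : ∀ a, D' (q a) = q (D a)) (hD : DiffOrderLT r D) : DiffOrderLT r D' := by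
  induction r generalizing D D' with
  | zero => exact hq.forall.2 fun a => by rw [h, hD, map_zero]
  | succ r ih =>
    refine hq.forall.2 fun a => ih (fun b => ?_) (hD a)
    rw [← map_mul, h, h, map_sub, map_mul]

theorem mem_HCdiff (hq : Function.Surjective q) (h : IsImage q φ ψ) (hφ : φ ∈ HCdiff A) :
    ψ ∈ HCdiff B := by
  have hL := List.map_surjective_iff.2 hq
  obtain ⟨⟨hlin, N, hN⟩, hd⟩ := hφ
  refine ⟨⟨?_, N, hL.forall.2 fun L hn => ?_⟩, fun k => ?_⟩
  · refine hL.forall.2 fun K => hL.forall.2 fun L => hq.forall.2 fun a => hq.forall.2 fun b => ?_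
    intro s t
    simp only [← map_smul, ← map_add, ← List.map_cons, ← List.map_append, h _, hlin]
  · rw [h L, hN L (by simpa using hn), map_zero]
  · obtain ⟨r, hr⟩ := hd k
    refine ⟨r, hL.forall.2 fun K => hL.forall.2 fun L hk => ?_⟩
    refine diffOrderLT hq (fun a => ?_) (hr K L (by simpa using hk))
    rw [← h]
    simp

end IsImage

/-- The linear extension of `φ ↦ ψ` for `IsImage q φ ψ` to all cochains, defined by lifting the
arguments along the surjection `q`. -/
noncomputable def descend (hq : Function.Surjective q) : Cochain A →ₗ[ℝ] Cochain B where
  toFun φ L := q (φ (L.map (Function.surjInv hq)))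
  map_add' _ _ := funext fun _ => map_add q _ _
  map_smul' _ _ := funext fun _ => map_smul q _ _

theorem IsImage.descend_eq (hq : Function.Surjective q) {φ : Cochain A} {ψ : Cochain B}
    (h : IsImage q φ ψ) : descend hq φ = ψ := funext fun L => by
  change q (φ _) = _
  rw [← h, List.map_map, Function.comp_surjInv, List.map_id]

variable {C : Type*} [CommRing C] {π : C →+* A}

/-- The value of a `C`-multilinear cochain on the words in `A` depends, modulo the kernel of `q`,
only on the images of the letters if the kernel is generated by elements of `C`. -/
theorem isImage_descend (hq : Function.Surjective q)
    (hker : ∀ f, q f = 0 → f ∈ Ideal.span (π '' {u | q (π u) = 0}))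
    {φ : Cochain A} (hφ : φ ∈ HC A) (hl : φ ∈ HClinear π) : IsImage q φ (descend hq φ) := by
  have hadd (K L : List A) (a b : A) :
      φ (K ++ (a + b) :: L) = φ (K ++ a :: L) + φ (K ++ b :: L) := by
    simpa using hφ.1 K L a b 1 1
  have zero {f : A} (hf : q f = 0) (K L : List A) : q (φ (K ++ f :: L)) = 0 := by
    suffices ∀ g, q (φ (K ++ (g * f) :: L)) = 0 by simpa using this 1
    refine Submodule.span_induction (p := fun f _ => ∀ g, q (φ (K ++ (g * f) :: L)) = 0)
      ?_ ?_ ?_ ?_ (hker f hf)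
    · rintro _ ⟨u, hu, rfl⟩ g
      rw [mul_comm, hl, map_mul, show q (π u) = 0 from hu, zero_mul]
    · intro g
      have := hl K L 0 0
      rw [map_zero, zero_mul, zero_mul] at this
      rw [mul_zero, this, map_zero]
    · intro x y _ _ hx hy g
      rw [mul_add, hadd, map_add, hx, hy, add_zero]
    · intro a x _ hx g
      rw [smul_eq_mul, ← mul_assoc, hx]
  -- The letters are exchanged one after the other.
  have key (L L' : List A) (h : L.map q = L'.map q) (K : List A) :
      q (φ (K ++ L)) = q (φ (K ++ L')) := by
    induction L generalizing L' K with
    | nil => cases L' with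
      | nil => rfl
      | cons a L' => simp at h
    | cons a L ih => cases L' with
      | nil => simp at h
      | cons a' L' =>
        obtain ⟨ha, hL⟩ := List.cons.inj h
        have h1 := hadd K L (a - a') a'
        rw [sub_add_cancel] at h1
        have h2 := ih L' hL (K ++ [a'])
        rw [List.append_assoc, List.append_assoc] at h2
        rw [h1, map_add, zero (by rw [map_sub, ha, sub_self]), zero_add]
        exact h2
  intro L
  refine key _ _ ?_ []
  rw [List.map_map, Function.comp_surjInv, List.map_id]

/-- If the kernel of the surjection `q` is generated by elements of `C`, the `C`-multilinear
differential cochains of `A` induce differential cochains of `B`, and on cohomology this is a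
morphism of Gerstenhaber algebras. -/
theorem exists_isGerstenhaberHom_descend (hq : Function.Surjective q)
    (hker : ∀ f, q f = 0 → f ∈ Ideal.span (π '' {u | q (π u) = 0}))
    {G : GerstenhaberAlgebra ℝ (HH (HCdiff A ⊓ HClinear π)) (HH.deg (HCdiff A ⊓ HClinear π))}
    {G' : GerstenhaberAlgebra ℝ (HH (HCdiff B)) (HH.deg (HCdiff B))}
    (hG : IsInduced G) (hG' : IsInduced G') :
    ∃ ρ : HH (HCdiff A ⊓ HClinear π) →ₗ[ℝ] HH (HCdiff B),
      (∀ z : cocycles (HCdiff A ⊓ HClinear π), ∃ w : cocycles (HCdiff B), IsImage q z w ∧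
        ρ (HH.mk (HCdiff A ⊓ HClinear π) z) = HH.mk (HCdiff B) w) ∧ IsGerstenhaberHom G G' ρ := by
  have im {φ : Cochain A} (h : φ ∈ HCdiff A ⊓ HClinear π) : IsImage q φ (descend hq φ) :=
    isImage_descend hq hker h.1.1 h.2
  have hd {φ : Cochain A} (h : φ ∈ HCdiff A ⊓ HClinear π) :
      hochschild B (descend hq φ) = descend hq (hochschild A φ) :=
    ((im h).hochschild.descend_eq hq).symm
  have hr : ∀ z ∈ cocycles (HCdiff A ⊓ HClinear π), descend hq z ∈ cocycles (HCdiff B) := by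
    rintro z ⟨hz, hz'⟩
    refine ⟨(im hz).mem_HCdiff hq hz.1, ?_⟩
    change hochschild B _ = 0
    rw [hd hz, show hochschild A z = 0 from hz', map_zero]
  let ρ : HH (HCdiff A ⊓ HClinear π) →ₗ[ℝ] HH (HCdiff B) :=
    Submodule.mapQ _ _ ((descend hq).restrict hr) (by
      rintro ⟨_, hz⟩ ⟨θ, hθ, rfl⟩
      exact ⟨descend hq θ, (im hθ).mem_HCdiff hq hθ.1, hd hθ⟩)
  refine ⟨ρ, fun z => ⟨⟨descend hq z, hr z z.2⟩, im z.2.1, rfl⟩,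
    isGerstenhaberHom_of_cocycles hG hG' ρ (descend hq) hr (fun z => rfl) ?_ ?_ ?_ ?_⟩
  · exact fun k z hz h => (im hz.1).isHomog hq h
  · exact IsImage.unit.descend_eq hq
  · exact fun z hz w hw => ((im hz.1).cup (im hw.1)).descend_eq hq
  · exact fun k l z hz w hw _ _ => ((im hz.1).gBracket k l (im hw.1)).descend_eq hq

end Descent

end VertHH

/-! ### The cohomology of the vertical cochains and its restriction to the fibers -/

theorem mainTheorem5
    {EB : Type*} [NormedAddCommGroup EB] [NormedSpace ℝ EB] [FiniteDimensional ℝ EB]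
    {M : Type*} [TopologicalSpace M] [T2Space M] [ChartedSpace EB M]
    [IsManifold (modelWithCornersSelf ℝ EB) ∞ M]
    {F : Type*} [NormedAddCommGroup F] [NormedSpace ℝ F] [FiniteDimensional ℝ F]
    {E : M → Type*} [TopologicalSpace (Bundle.TotalSpace F E)] [∀ x, TopologicalSpace (E x)]
    [∀ x, AddCommGroup (E x)] [∀ x, Module ℝ (E x)]
    [FiberBundle F E] [VectorBundle ℝ F E]
    [ContMDiffVectorBundle ∞ F E (modelWithCornersSelf ℝ EB)] :
    ∃ (Gver : VertHH.GerstenhaberAlgebra ℝ (VertHH.HH (VertHH.HCver EB F E))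
          (VertHH.HH.deg (VertHH.HCver EB F E)))
      (Gdiff : VertHH.GerstenhaberAlgebra ℝ
          (VertHH.HH (VertHH.HCdiff (VertHH.CInfTotal EB F E)))
          (VertHH.HH.deg (VertHH.HCdiff (VertHH.CInfTotal EB F E)))),
      VertHH.IsInduced Gver ∧ VertHH.IsInduced Gdiff ∧
      VertHH.IsGerstenhaberHom Gver Gdiff (VertHH.HH.map (VertHH.HCver_le EB F E)) ∧
      ∀ p : M,
        (∀ φ ∈ VertHH.HCver EB F E, ∃! ψ : VertHH.Cochain (VertHH.smoothFun (E p)),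
          ψ ∈ VertHH.HCdiff (VertHH.smoothFun (E p)) ∧ VertHH.IsRestriction EB F E p φ ψ) ∧
        ∃ (Gp : VertHH.GerstenhaberAlgebra ℝ
              (VertHH.HH (VertHH.HCdiff (VertHH.smoothFun (E p))))
              (VertHH.HH.deg (VertHH.HCdiff (VertHH.smoothFun (E p)))))
          (ρ : VertHH.HH (VertHH.HCver EB F E) →ₗ[ℝ]
              VertHH.HH (VertHH.HCdiff (VertHH.smoothFun (E p)))),
          VertHH.IsInduced Gp ∧
          (∀ z : VertHH.cocycles (VertHH.HCver EB F E),
            ∃ w : VertHH.cocycles (VertHH.HCdiff (VertHH.smoothFun (E p))),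
              VertHH.IsRestriction EB F E p z w ∧
              ρ (VertHH.HH.mk (VertHH.HCver EB F E) z) =
                VertHH.HH.mk (VertHH.HCdiff (VertHH.smoothFun (E p))) w) ∧
          VertHH.IsGerstenhaberHom Gver Gp ρ := by
  obtain ⟨Gver, hver⟩ :=
    (VertHH.braceClosed_HCdiff_inf_HClinear (VertHH.pullback EB F E)).exists_gerstenhaber
  obtain ⟨Gdiff, hdiff⟩ :=
    (VertHH.braceClosed_HCdiff (A := VertHH.CInfTotal EB F E)).exists_gerstenhaber
  refine ⟨Gver, Gdiff, hver, hdiff, ?_, fun p => ?_⟩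
  · exact VertHH.isGerstenhaberHom_of_cocycles hver hdiff _ id
      (fun z hz => ⟨hz.1.1, hz.2⟩) (fun z => rfl) (fun k z _ h => h) rfl
      (fun _ _ _ _ => rfl) (fun _ _ _ _ _ _ _ _ => rfl)
  · have hq := VertHH.restrict_surjective (EB := EB) (F := F) (E := E) p
    have hker : ∀ f, VertHH.restrictHom EB F E p f = 0 → f ∈ Ideal.span (VertHH.pullback EB F E ''
        {u | VertHH.restrictHom EB F E p (VertHH.pullback EB F E u) = 0}) := fun f hf =>
      Ideal.span_mono (Set.image_mono fun u hu => Subtype.ext (funext fun _ => hu))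
        (VertHH.mem_span_of_restrict_eq_zero p hf)
    refine ⟨fun φ hφ => ?_, ?_⟩
    · have h := VertHH.isImage_descend hq hker hφ.1.1 hφ.2
      exact ⟨_, ⟨h.mem_HCdiff hq hφ.1, h⟩, fun ψ hψ => (VertHH.IsImage.descend_eq hq hψ.2).symm⟩
    · obtain ⟨Gp, hp⟩ :=
        (VertHH.braceClosed_HCdiff (A := VertHH.smoothFun (E p))).exists_gerstenhaber
      obtain ⟨ρ, h, hρ⟩ := VertHH.exists_isGerstenhaberHom_descend hq hker hver hp
      exact ⟨Gp, ρ, hp, h, hρ⟩
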